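/- **Setting.** Let $(\Omega,\mathcal F,P)$ be a complete probability space, $\theta:\Omega\to\Omega$ an invertible (bimeasurable) ergodic $P$-preserving map, and $(\mathcal X,\rho)$ a compact metric space with its Borel $\sigma$-algebra. Let $T_\omega:\mathcal X\to\mathcal X$, $\omega\in\Omega$, be continuous surjective maps such that $(\omega,x)\mapsto T_\omega x$ is measurable, and put $T_\omega^n=T_{\theta^{n-1}\omega}\circ\cdots\circ T_\omega$. Assume that there are $\xi>0$ and random variables $n_\omega\in\mathbb N$, $\gamma_\omega>1$, $D_\omega$, with $n_\omega,D_\omega$ bounded and $\gamma_\omega-1$ bounded below by a positive constant, such that $P$-a.s.: (a) $T_\omega^{n_\omega}(B(x,\xi))=\mathcal X$ for all $x\in\mathcal X$; (b) whenever $\rho(x,x')<\xi$ one can list without repetitions $T_\omega^{-1}\{x\}=\{y_1,\dots,y_k\}$ and $T_\omega^{-1}\{x'\}=\{y'_1,\dots,y'_k\}$ with $k\le D_\omega$ and $\rho(y_i,y_i')\le\gamma_\omega^{-1}\rho(x,x')$ for all $i$. Let $\alpha\in(0,1]$. For $g:\mathcal X\to\mathbb R$ put $\|g\|_{\alpha,\xi}=\|g\|_\infty+\inf\{R:|g(x)-g(x')|\le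 R\rho(x,x')^\alpha\text{ if }\rho(x,x')<\xi\}$. Let $\phi:\Omega\times\mathcal X\to\mathbb R$ be measurable with $\|\phi_\omega\|_{\alpha,\xi}$ bounded ($P$-a.s. by a constant), put $\mathcal L_0^\omega g(x)=\sum_{y\in T_\omega^{-1}\{x\}}e^{\phi_\omega(y)}g(y)$, and assume that $(\omega,x)\mapsto\mathcal L_0^\omega g_\omega(x)$ is measurable for every measurable $g:\Omega\times\mathcal X\to\mathbb R$. An *RPF triplet* of $(\mathcal L_0^\omega)$ consists of random variables $\lambda_\omega(0)>0$, strictly positive functions $h_\omega(0)$ with $(\omega,x)\mapsto h_\omega(0)(x)$ measurable, and probability measures $\nu_\omega(0)$ on $\mathcal X$ depending measurably on $\omega$, such that $\lambda_\omega(0)$ and $\|h_\omega(0)\|_{\alpha,\xi}$ are $P$-a.s. bounded by a constant and, $P$-a.s., $\mathcal L_0^\omega h_\omega(0)=\lambda_\omega(0)h_{\theta\omega}(0)$, $\int\mathcal L_0^\omega g\,d\nu_{\theta\omega}(0)=\lambda_\omega(0)\int g\,d\nu_\omega(0)$ for all $g$ with $\|g\|_{\alpha,\xi}<\infty$, and $\int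 h_\omega(0)\,d\nu_\omega(0)=1$. Let $\mathbf m$ be a Borel probability measure on $\mathcal X$ such that $P$-a.s. $T_\omega$ is non-singular with respect to $\mathbf m$ (that is, $\mathbf m(T_\omega^{-1}N)=0$ whenever $\mathbf m(N)=0$) and has a Jacobian $J_\omega=\frac{d(T_\omega)_*\mathbf m}{d\mathbf m}:\mathcal X\to[0,\infty)$, that is, a measurable function with $\mathbf m(T_\omega A)=\int_A J_\omega\,d\mathbf m$ for every Borel set $A$ on which $T_\omega$ is injective. **Proposition.** 1. Suppose that $\phi_\omega=-\ln J_\omega$ $\mathbf m$-a.e., $P$-a.s. Then an RPF triplet exists, and every RPF triplet satisfies $\nu_\omega(0)=\mathbf m$ and $\lambda_\omega(0)=1$, $P$-a.s. 2. Suppose that $\phi_\omega=-\ln J_\omega+\psi_\omega-\psi_{\theta\omega}\circ T_\omega+K_\omega$ $\mathbf m$-a.e., $P$-a.s., for some bounded measurable function $\psi_\omega(x)=\psi(\omega,x)$ on $\Omega\times\mathcal X$ and some random variable $K_\omega$. Then an RPF triplet exists, and for every RPF triplet there are constants $0<c\le C<\infty$ such that, $P$-a.s., $\nu_\omega(0)$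 is equivalent to $\mathbf m$ with $c\le\frac{d\nu_\omega(0)}{d\mathbf m}\le C$ $\mathbf m$-a.e., and the same holds for the Gibbs measure $\mu_\omega=h_\omega(0)\,\nu_\omega(0)$ in place of $\nu_\omega(0)$. -/

import Mathlib

open MeasureTheory
open scoped NNReal ENNReal

namespace RandomRPF

/-- The norm `‖g‖_{α,ξ} = ‖g‖_∞ + v_{α,ξ}(g)`, with value `∞` when `g` is not in `ℋ^{α,ξ}`. Here
`v_{α,ξ}(g)` is the infimum of all `R` such that `|g x - g x'| ≤ R ρ(x,x')^α` whenever
`ρ(x,x') < ξ`. -/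
noncomputable def holderNorm {X : Type*} [MetricSpace X] (α ξ : ℝ) (g : X → ℝ) : ℝ≥0∞ :=
  (⨆ x, ‖g x‖ₑ) +
    ⨅ (R : ℝ≥0) (_ : ∀ x x' : X, dist x x' < ξ → |g x - g x'| ≤ R * dist x x' ^ α), (R : ℝ≥0∞)

/-- The transfer operator `(ℒ g)(x) = ∑_{y ∈ S⁻¹{x}} e^{f y} g y` of a (finite-to-one) map `S` and a
potential `f`. -/
noncomputable def transferOp {X : Type*} (S : X → X) (f g : X → ℝ) (x : X) : ℝ :=
  ∑ᶠ (y : X) (_ : y ∈ S ⁻¹' {x}), Real.exp (f y) * g y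

/-- The iterate `T_ω^n = T_{θ^{n-1}ω} ∘ ⋯ ∘ T_{θω} ∘ T_ω`. -/
def fiberIterate {Ω X : Type*} (θ : Ω → Ω) (T : Ω → X → X) : ℕ → Ω → X → X
  | 0, _, x => x
  | n + 1, ω, x => T (θ^[n] ω) (fiberIterate θ T n ω x)

/-- `(T_ω)` is a random (uniformly) distance expanding family of continuous surjective maps:
topological exactness and the pairing property at scale `ξ`, with `n_ω` and `D_ω` bounded and
`γ_ω - 1` bounded away from zero. -/
structure IsRandomExpanding {Ω X : Type*} [MeasurableSpace Ω] [MetricSpace X] [MeasurableSpace X]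
    (P : Measure Ω) (θ : Ω → Ω) (T : Ω → X → X) (ξ : ℝ) : Prop where
  continuous : ∀ ω, Continuous (T ω)
  surjective : ∀ ω, Function.Surjective (T ω)
  measurable : Measurable (fun p : Ω × X => T p.1 p.2)
  pos : 0 < ξ
  exact : ∃ n : Ω → ℕ, Measurable n ∧ (∃ N : ℕ, ∀ᵐ ω ∂P, n ω ≤ N) ∧
    ∀ᵐ ω ∂P, ∀ x : X, fiberIterate θ T (n ω) ω '' Metric.ball x ξ = Set.univ
  pairing : ∃ γ D : Ω → ℝ, Measurable γ ∧ Measurable D ∧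
    (∃ δ : ℝ, 0 < δ ∧ ∀ᵐ ω ∂P, 1 + δ ≤ γ ω) ∧ (∃ C : ℝ, ∀ᵐ ω ∂P, D ω ≤ C) ∧
    ∀ᵐ ω ∂P, ∀ x x' : X, dist x x' < ξ →
      ∃ (k : ℕ) (y y' : Fin k → X), (k : ℝ) ≤ D ω ∧
        Function.Injective y ∧ Function.Injective y' ∧
        Set.range y = T ω ⁻¹' {x} ∧ Set.range y' = T ω ⁻¹' {x'} ∧
        ∀ i, dist (y i) (y' i) ≤ (γ ω)⁻¹ * dist x x'

/-- The potential `φ` is measurable, `‖φ_ω‖_{α,ξ}` is bounded, and the transfer operators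
`ℒ^ω = ℒ_0^ω` of `T_ω` and `φ_ω` are measurable. -/
structure IsPotential {Ω X : Type*} [MeasurableSpace Ω] [MetricSpace X] [MeasurableSpace X]
    (P : Measure Ω) (T : Ω → X → X) (α ξ : ℝ) (φ : Ω → X → ℝ) : Prop where
  measurable : Measurable (fun p : Ω × X => φ p.1 p.2)
  bounded : ∃ C : ℝ≥0, ∀ᵐ ω ∂P, holderNorm α ξ (φ ω) ≤ C
  transfer : ∀ g : Ω → X → ℝ, Measurable (fun p : Ω × X => g p.1 p.2) →
    Measurable (fun p : Ω × X => transferOp (T p.1) (φ p.1) (g p.1) p.2)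

/-- `J` is the Jacobian of `S` with respect to `m`: `m (S A) = ∫_A J dm` for every Borel set `A` on
which `S` is injective. -/
structure IsJacobian {X : Type*} [MeasurableSpace X] (m : Measure X) (S : X → X)
    (J : X → ℝ≥0) : Prop where
  measurable : Measurable J
  image : ∀ A : Set X, MeasurableSet A → Set.InjOn S A → m (S '' A) = ∫⁻ x in A, J x ∂m

/-- `(lam ω, h ω, ν ω)` is a (random, real) Ruelle-Perron-Frobenius triplet of the transfer
operators `ℒ^ω = ℒ_0^ω` of `T_ω` and `φ_ω`. -/
structure IsRPFTriplet {Ω X : Type*} [MeasurableSpace Ω] [MetricSpace X] [MeasurableSpace X]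
    (P : Measure Ω) (θ : Ω → Ω) (T : Ω → X → X) (α ξ : ℝ) (φ : Ω → X → ℝ)
    (lam : Ω → ℝ) (h : Ω → X → ℝ) (ν : Ω → Measure X) : Prop where
  measurable_lam : Measurable lam
  measurable_h : Measurable (fun p : Ω × X => h p.1 p.2)
  measurable_ν : Measurable ν
  lam_pos : ∀ᵐ ω ∂P, 0 < lam ω
  h_pos : ∀ᵐ ω ∂P, ∀ x, 0 < h ω x
  prob : ∀ᵐ ω ∂P, IsProbabilityMeasure (ν ω)
  bounded : ∃ C : ℝ≥0, ∀ᵐ ω ∂P, lam ω ≤ C ∧ holderNorm α ξ (h ω) ≤ C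
  /-- `ℒ^ω h_ω = λ_ω h_{θω}`. -/
  eigenfunction : ∀ᵐ ω ∂P, ∀ x, transferOp (T ω) (φ ω) (h ω) x = lam ω * h (θ ω) x
  /-- `(ℒ^ω)^* ν_{θω} = λ_ω ν_ω` as functionals on `ℋ^{α,ξ}`. -/
  eigenmeasure : ∀ᵐ ω ∂P, ∀ g : X → ℝ, holderNorm α ξ g < ∞ →
    ∫ x, transferOp (T ω) (φ ω) g x ∂(ν (θ ω)) = lam ω * ∫ x, g x ∂(ν ω)
  normalized : ∀ᵐ ω ∂P, ∫ x, h ω x ∂(ν ω) = 1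

/-- `μ` and `m` are equivalent and `c ≤ dμ/dm ≤ C` holds `m`-almost everywhere. -/
def EquivWithBounds {X : Type*} [MeasurableSpace X] (μ m : Measure X) (c C : ℝ) : Prop :=
  μ ≪ m ∧ m ≪ μ ∧ ∀ᵐ x ∂m, ENNReal.ofReal c ≤ μ.rnDeriv m x ∧ μ.rnDeriv m x ≤ ENNReal.ofReal C

end RandomRPF

namespace RandomRPF

/-! The dual eigenmeasures are explicit. Change of variables along the inverse branches, with `J *
exp (-log J) = 1` a.e., gives `∫ e^{ψ_{θω}} ℒ^ω g dm = e^{K_ω} ∫ e^{ψ_ω} g dm`. So the probabilities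
`Z_ω⁻¹ e^{ψ_ω} m`, with `Z_ω = ∫ e^{ψ_ω} dm`, form a conformal family with eigenvalues `e^{K_ω} Z_ω
/ Z_{θω}` (`isConformal_expDensity`). For `ψ = 0` and `K = 0` this is `m` with eigenvalue `1`.

The remaining claims come from contraction on a cone. Dividing the transfer operators by the
eigenvalues of a conformal family makes them preserve integrals. Pairing of fibres improves the
log-Hölder constant from `Q` to `s Q` with `s < 1`, and exactness bounds the `N`-th iterate of `g`
below by `c ∫ g`. A Doeblin splitting follows: a fixed fraction of the mean can be removed as a
constant while the rest stays in the cone. Two cone functions of equal mean are therefore merged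
exponentially fast (`exists_loss_of_memory`).

This has three consequences. Pulled-back iterates of `1` converge to an eigenfunction, so a triplet
exists (`IsConformal.exists_triplet`). Any conformal family agrees with the given one
(`IsConformal.ae_unique`). The eigenfunction of any triplet is uniformly positive
(`IsRPFTriplet.exists_bounds`). Hence `ν_ω` always has density `Z_ω⁻¹ e^{ψ_ω}`, and `h_ω ν_ω`
differs from it by a factor bounded away from `0` and `∞`. -/

/-! ### The cone of log-Hölder functions -/

/-- The cone of nonnegative functions `g` with `g x ≤ exp (Q ρ(x,x')^α) g x'` whenever
`ρ(x,x') < ξ`. -/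
structure LogHolder {X : Type*} [MetricSpace X] (α ξ Q : ℝ) (g : X → ℝ) : Prop where
  nonneg : ∀ x, 0 ≤ g x
  le_exp_mul : ∀ x x', dist x x' < ξ → g x ≤ Real.exp (Q * dist x x' ^ α) * g x'

namespace LogHolder

variable {X : Type*} [MetricSpace X] {α ξ Q : ℝ} {g : X → ℝ}

theorem mono {Q' : ℝ} (hg : LogHolder α ξ Q g) (h : Q ≤ Q') : LogHolder α ξ Q' g :=
  ⟨hg.nonneg, fun x x' hx => (hg.le_exp_mul x x' hx).trans <|
    mul_le_mul_of_nonneg_right (Real.exp_le_exp.2 <|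
      mul_le_mul_of_nonneg_right h (Real.rpow_nonneg dist_nonneg _)) (hg.nonneg x')⟩

theorem const (hQ : 0 ≤ Q) {c : ℝ} (hc : 0 ≤ c) : LogHolder α ξ Q (fun _ : X => c) :=
  ⟨fun _ => hc, fun _ _ _ => le_mul_of_one_le_left hc <|
    Real.one_le_exp (mul_nonneg hQ (Real.rpow_nonneg dist_nonneg _))⟩

theorem const_mul (hg : LogHolder α ξ Q g) {c : ℝ} (hc : 0 ≤ c) :
    LogHolder α ξ Q (fun x => c * g x) :=
  ⟨fun x => mul_nonneg hc (hg.nonneg x), fun x x' hx => by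
    nlinarith [mul_le_mul_of_nonneg_left (hg.le_exp_mul x x' hx) hc]⟩

/-- The gap between `s * Q` and `Q` pays for the subtraction: by convexity `e^{sz} ≤ s e^z + (1 -
s)`, which leaves `(1 - s) (e^z - 1) g x'`, at least `t (e^z - 1)`. -/
theorem sub_const {s t : ℝ} (hg : LogHolder α ξ (s * Q) g) (hQ : 0 ≤ Q) (hs : 0 ≤ s) (hs1 : s ≤ 1)
    (ht : ∀ x, t ≤ (1 - s) * g x) : LogHolder α ξ Q (fun x => g x - t) := by
  refine ⟨fun x => ?_, fun x x' hx => ?_⟩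
  · have := ht x
    have := mul_nonneg hs (hg.nonneg x)
    linarith
  · have hz : 0 ≤ Q * dist x x' ^ α := mul_nonneg hQ (Real.rpow_nonneg dist_nonneg _)
    have h1 := hg.le_exp_mul x x' hx
    rw [mul_assoc] at h1
    set z := Q * dist x x' ^ α
    have hconv := convexOn_exp.2 (Set.mem_univ z) (Set.mem_univ 0) hs (sub_nonneg.2 hs1)
      (by ring)
    simp only [smul_eq_mul, mul_zero, add_zero, Real.exp_zero, mul_one] at hconv
    have h2 : 0 ≤ Real.exp z - 1 := sub_nonneg.2 (Real.one_le_exp hz)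
    have h3 := mul_le_mul_of_nonneg_right (ht x') h2
    have h4 := mul_le_mul_of_nonneg_right hconv (hg.nonneg x')
    nlinarith

theorem continuous (hg : LogHolder α ξ Q g) (hα : 0 < α) (hξ : 0 < ξ) : Continuous g := by
  rw [continuous_iff_continuousAt]
  intro x
  have hd : Filter.Tendsto (fun y => Q * dist y x ^ α) (nhds x) (nhds 0) := by
    have : Continuous fun y => Q * dist y x ^ α :=
      continuous_const.mul ((continuous_id.dist continuous_const).rpow_const
        fun _ => Or.inr hα.le)
    simpa [Real.zero_rpow hα.ne'] using this.tendsto x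
  have hup : Filter.Tendsto (fun y => Real.exp (Q * dist y x ^ α) * g x) (nhds x) (nhds (g x)) := by
    simpa using ((Real.continuous_exp.tendsto 0).comp hd).mul_const (g x)
  have hlo : Filter.Tendsto (fun y => Real.exp (-(Q * dist y x ^ α)) * g x) (nhds x)
      (nhds (g x)) := by
    have hd' := hd.neg
    rw [neg_zero] at hd'
    simpa using ((Real.continuous_exp.tendsto 0).comp hd').mul_const (g x)
  have hball : ∀ᶠ y in nhds x, dist y x < ξ := Metric.ball_mem_nhds x hξ
  refine tendsto_of_tendsto_of_tendsto_of_le_of_le' hlo hup ?_ ?_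
  · filter_upwards [hball] with y hy
    have h := hg.le_exp_mul x y (by rwa [dist_comm])
    rw [dist_comm x y] at h
    rw [Real.exp_neg, inv_mul_le_iff₀ (Real.exp_pos _)]
    exact h
  · filter_upwards [hball] with y hy using hg.le_exp_mul y x hy

theorem integrable [CompactSpace X] [MeasurableSpace X] [BorelSpace X]
    (hg : LogHolder α ξ Q g) (hα : 0 < α) (hξ : 0 < ξ) (μ : Measure X) [IsFiniteMeasure μ] :
    Integrable g μ :=
  (hg.continuous hα hξ).integrable_of_hasCompactSupport (HasCompactSupport.of_compactSpace g)

/-- Once the shifted function is at least `R / Q`, the additive error `R d^α` is at most `Q d^α`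
times its value, and `1 + z ≤ e^z` makes it multiplicative. -/
theorem add_const_of_holder {R q : ℝ} (hQ : 0 < Q) (hR : 0 ≤ R)
    (hg : ∀ x x', dist x x' < ξ → |g x - g x'| ≤ R * dist x x' ^ α)
    (hq : ∀ x, R / Q ≤ g x + q) : LogHolder α ξ Q (fun x => g x + q) := by
  have h0 : ∀ x, 0 ≤ g x + q := fun x => (div_nonneg hR hQ.le).trans (hq x)
  refine ⟨h0, fun x x' hx => ?_⟩
  have h1 := (le_abs_self _).trans (hg x x' hx)
  have hd : 0 ≤ dist x x' ^ α := Real.rpow_nonneg dist_nonneg _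
  have h2 := Real.add_one_le_exp (Q * dist x x' ^ α)
  have h3 := mul_le_mul_of_nonneg_right h2 (h0 x')
  have h4 := (div_le_iff₀ hQ).1 (hq x')
  have h5 := mul_le_mul_of_nonneg_right h4 hd
  nlinarith

theorem of_tendsto {u : ℕ → X → ℝ} (hu : ∀ n, LogHolder α ξ Q (u n))
    (h : ∀ x, Filter.Tendsto (fun n => u n x) Filter.atTop (nhds (g x))) : LogHolder α ξ Q g :=
  ⟨fun x => ge_of_tendsto' (h x) fun n => (hu n).nonneg x,
    fun x x' hx => le_of_tendsto_of_tendsto' (h x) ((h x').const_mul _)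
      fun n => (hu n).le_exp_mul x x' hx⟩

end LogHolder

/-! ### Iterates of a cocycle of operators -/

/-- The iterate `L_{θ^{n-1}ω} ∘ ⋯ ∘ L_ω` of a family of operators. -/
def iterOp {Ω X : Type*} (L : Ω → (X → ℝ) → X → ℝ) (θ : Ω → Ω) : ℕ → Ω → (X → ℝ) → X → ℝ
  | 0, _, g => g
  | n + 1, ω, g => L (θ^[n] ω) (iterOp L θ n ω g)

/-- The functions `L_{θ^{-1}ω} ∘ ⋯ ∘ L_{θ^{-n}ω} 1`, where `θi` is the inverse of `θ`. -/
def pullbackOne {Ω X : Type*} (L : Ω → (X → ℝ) → X → ℝ) (θi : Ω → Ω) : ℕ → Ω → X → ℝ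
  | 0, _ => fun _ => 1
  | n + 1, ω => L (θi ω) (pullbackOne L θi n (θi ω))

theorem iterOp_add {Ω X : Type*} (L : Ω → (X → ℝ) → X → ℝ) (θ : Ω → Ω) (n p : ℕ) (ω : Ω)
    (g : X → ℝ) : iterOp L θ (n + p) ω g = iterOp L θ p (θ^[n] ω) (iterOp L θ n ω g) := by
  induction p with
  | zero => rfl
  | succ p ih =>
    rw [← add_assoc, iterOp, iterOp, ih, ← Function.iterate_add_apply, add_comm p n]

theorem pullbackOne_eq_iterOp {Ω X : Type*} (L : Ω → (X → ℝ) → X → ℝ) {θ θi : Ω → Ω}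
    (hθ : Function.LeftInverse θ θi) (n : ℕ) (ω : Ω) :
    pullbackOne L θi n ω = iterOp L θ n (θi^[n] ω) (fun _ => 1) := by
  induction n generalizing ω with
  | zero => rfl
  | succ n ih =>
    rw [pullbackOne, ih, iterOp, Function.iterate_succ_apply, hθ.iterate n]

/-- Families of positive operators `L_ω` over `θ`, normalised by `L_ω^* m_{θω} = m_ω`, which
improve the log-Hölder constant and dominate the composition operators of a topologically exact
family of maps `S_ω`, uniformly over the forward invariant set `G`. -/
structure NormalizedCocycle {Ω X : Type*} [MetricSpace X] [MeasurableSpace X]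
    (G : Set Ω) (θ : Ω → Ω) (S : Ω → X → X) (L : Ω → (X → ℝ) → X → ℝ) (m : Ω → Measure X)
    (α ξ Q s a A : ℝ) (N : ℕ) : Prop where
  mapsTo : ∀ ω ∈ G, θ ω ∈ G
  prob : ∀ ω ∈ G, IsProbabilityMeasure (m ω)
  α_pos : 0 < α
  ξ_pos : 0 < ξ
  Q_pos : 0 < Q
  s_nonneg : 0 ≤ s
  s_lt_one : s < 1
  a_pos : 0 < a
  A_nonneg : 0 ≤ A
  N_pos : 0 < N
  surjective : ∀ ω ∈ G, Function.Surjective (S ω)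
  add : ∀ ω ∈ G, ∀ f g, L ω (fun x => f x + g x) = fun x => L ω f x + L ω g x
  const_mul : ∀ ω ∈ G, ∀ (c : ℝ) g, L ω (fun x => c * g x) = fun x => c * L ω g x
  lower : ∀ ω ∈ G, ∀ g : X → ℝ, (∀ x, 0 ≤ g x) → ∀ x, a * g x ≤ L ω g (S ω x)
  upper : ∀ ω ∈ G, ∀ x, L ω (fun _ => 1) x ≤ A
  logHolder : ∀ ω ∈ G, ∀ g, LogHolder α ξ Q g → LogHolder α ξ (s * Q) (L ω g)
  integral : ∀ ω ∈ G, ∀ g, LogHolder α ξ Q g → ∫ x, L ω g x ∂(m (θ ω)) = ∫ x, g x ∂(m ω)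
  exact : ∀ ω ∈ G, ∀ x, fiberIterate θ S N ω '' Metric.ball x ξ = Set.univ

namespace NormalizedCocycle

variable {Ω X : Type*} [MetricSpace X] [MeasurableSpace X]
  {G : Set Ω} {θ : Ω → Ω} {S : Ω → X → X} {L : Ω → (X → ℝ) → X → ℝ} {m : Ω → Measure X}
  {α ξ Q s a A : ℝ} {N : ℕ}

theorem iterate_mem (H : NormalizedCocycle G θ S L m α ξ Q s a A N) {ω : Ω} (hω : ω ∈ G) (n : ℕ) :
    θ^[n] ω ∈ G := by
  induction n with
  | zero => exact hω
  | succ n ih => rw [Function.iterate_succ_apply']; exact H.mapsTo _ ih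

/-- Positivity is not an axiom of the structure: it follows from the lower bound at a preimage of
`x`. -/
theorem nonneg (H : NormalizedCocycle G θ S L m α ξ Q s a A N) {ω : Ω} (hω : ω ∈ G)
    {g : X → ℝ} (hg : ∀ x, 0 ≤ g x) (x : X) : 0 ≤ L ω g x := by
  obtain ⟨z, rfl⟩ := H.surjective ω hω x
  exact (mul_nonneg H.a_pos.le (hg z)).trans (H.lower ω hω g hg z)

theorem iterOp_plus (H : NormalizedCocycle G θ S L m α ξ Q s a A N) {ω : Ω} (hω : ω ∈ G) (n : ℕ)
    (f g : X → ℝ) :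
    iterOp L θ n ω (fun x => f x + g x) = fun x => iterOp L θ n ω f x + iterOp L θ n ω g x := by
  induction n with
  | zero => rfl
  | succ n ih => rw [iterOp, ih, H.add _ (H.iterate_mem hω n)]; rfl

theorem iterOp_const_mul (H : NormalizedCocycle G θ S L m α ξ Q s a A N) {ω : Ω} (hω : ω ∈ G)
    (n : ℕ) (c : ℝ) (g : X → ℝ) :
    iterOp L θ n ω (fun x => c * g x) = fun x => c * iterOp L θ n ω g x := by
  induction n with
  | zero => rfl
  | succ n ih => rw [iterOp, ih, H.const_mul _ (H.iterate_mem hω n)]; rfl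

theorem iterOp_nonneg (H : NormalizedCocycle G θ S L m α ξ Q s a A N) {ω : Ω} (hω : ω ∈ G)
    {g : X → ℝ} (hg : ∀ x, 0 ≤ g x) (n : ℕ) (x : X) : 0 ≤ iterOp L θ n ω g x := by
  induction n generalizing x with
  | zero => exact hg x
  | succ n ih => exact H.nonneg (H.iterate_mem hω n) ih x

theorem lower_iterOp (H : NormalizedCocycle G θ S L m α ξ Q s a A N) {ω : Ω} (hω : ω ∈ G)
    {g : X → ℝ} (hg : ∀ x, 0 ≤ g x) (n : ℕ) (x : X) :
    a ^ n * g x ≤ iterOp L θ n ω g (fiberIterate θ S n ω x) := by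
  induction n with
  | zero => simp [iterOp, fiberIterate]
  | succ n ih =>
    rw [pow_succ', mul_assoc]
    exact (mul_le_mul_of_nonneg_left ih H.a_pos.le).trans
      (H.lower _ (H.iterate_mem hω n) _ (H.iterOp_nonneg hω hg n) _)

theorem sub_apply (H : NormalizedCocycle G θ S L m α ξ Q s a A N) {ω : Ω} (hω : ω ∈ G)
    (f g : X → ℝ) (x : X) : L ω (fun x => f x - g x) x = L ω f x - L ω g x := by
  have h := congrFun (H.add ω hω (fun x => f x - g x) g) x
  simp only [sub_add_cancel] at h
  linarith

theorem upper_of_le (H : NormalizedCocycle G θ S L m α ξ Q s a A N) {ω : Ω} (hω : ω ∈ G)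
    {g : X → ℝ} {M : ℝ} (hM0 : 0 ≤ M) (hM : ∀ x, g x ≤ M) (x : X) : L ω g x ≤ A * M := by
  have h := H.sub_apply hω (fun _ => M * 1) g x
  have h1 : 0 ≤ L ω (fun x => M * 1 - g x) x := H.nonneg hω (fun y => by linarith [hM y]) x
  have h2 := congrFun (H.const_mul ω hω M (fun _ => 1)) x
  have h3 := mul_le_mul_of_nonneg_left (H.upper ω hω x) hM0
  beta_reduce at h h2
  linarith

theorem upper_iterOp (H : NormalizedCocycle G θ S L m α ξ Q s a A N) {ω : Ω} (hω : ω ∈ G)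
    {g : X → ℝ} {M : ℝ} (hM0 : 0 ≤ M) (hM : ∀ x, g x ≤ M) (n : ℕ) (x : X) :
    iterOp L θ n ω g x ≤ A ^ n * M := by
  induction n generalizing x with
  | zero => simpa [iterOp] using hM x
  | succ n ih =>
    rw [pow_succ', mul_assoc]
    exact H.upper_of_le (H.iterate_mem hω n) (mul_nonneg (pow_nonneg H.A_nonneg n) hM0) ih x

theorem sQ_le (H : NormalizedCocycle G θ S L m α ξ Q s a A N) : s * Q ≤ Q :=
  mul_le_of_le_one_left H.Q_pos.le H.s_lt_one.le

theorem logHolder_iterOp (H : NormalizedCocycle G θ S L m α ξ Q s a A N) {ω : Ω} (hω : ω ∈ G)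
    {g : X → ℝ} (hg : LogHolder α ξ Q g) (n : ℕ) : LogHolder α ξ Q (iterOp L θ n ω g) := by
  induction n with
  | zero => exact hg
  | succ n ih => exact (H.logHolder _ (H.iterate_mem hω n) _ ih).mono H.sQ_le

theorem integral_iterOp (H : NormalizedCocycle G θ S L m α ξ Q s a A N) {ω : Ω} (hω : ω ∈ G)
    {g : X → ℝ} (hg : LogHolder α ξ Q g) (n : ℕ) :
    ∫ x, iterOp L θ n ω g x ∂(m (θ^[n] ω)) = ∫ x, g x ∂(m ω) := by
  induction n with
  | zero => rfl
  | succ n ih =>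
    rw [Function.iterate_succ_apply', ← ih]
    exact H.integral _ (H.iterate_mem hω n) _ (H.logHolder_iterOp hω hg n)

/-- By exactness `x` has an `N`-step preimage `z` within `ξ` of `y`. The branch through `z`
contributes at least `a ^ N * g z`, and the cone condition compares `g z` with `g y`. -/
theorem minorization (H : NormalizedCocycle G θ S L m α ξ Q s a A N) {ω : Ω} (hω : ω ∈ G)
    {g : X → ℝ} (hg : LogHolder α ξ Q g) (x y : X) :
    a ^ N * Real.exp (-(Q * ξ ^ α)) * g y ≤ iterOp L θ N ω g x := by
  obtain ⟨z, hz, rfl⟩ : x ∈ fiberIterate θ S N ω '' Metric.ball y ξ := by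
    rw [H.exact ω hω y]; trivial
  refine le_trans ?_ (H.lower_iterOp hω hg.nonneg N z)
  rw [mul_assoc]
  refine mul_le_mul_of_nonneg_left ?_ (pow_nonneg H.a_pos.le N)
  rw [Real.exp_neg, inv_mul_le_iff₀ (Real.exp_pos _)]
  have hd : dist y z < ξ := by rw [dist_comm]; exact hz
  refine (hg.le_exp_mul y z hd).trans (mul_le_mul_of_nonneg_right ?_ (hg.nonneg z))
  exact Real.exp_le_exp.2 <| mul_le_mul_of_nonneg_left
    (Real.rpow_le_rpow dist_nonneg hd.le H.α_pos.le) H.Q_pos.le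

/-! ### Doeblin bounds and exponential loss of memory -/

variable [CompactSpace X] [BorelSpace X]

theorem integral_minorization (H : NormalizedCocycle G θ S L m α ξ Q s a A N) {ω : Ω} (hω : ω ∈ G)
    {g : X → ℝ} (hg : LogHolder α ξ Q g) (x : X) :
    a ^ N * Real.exp (-(Q * ξ ^ α)) * ∫ y, g y ∂(m ω) ≤ iterOp L θ N ω g x := by
  have := H.prob ω hω
  rw [← integral_const_mul]
  refine (integral_mono (μ := m ω) ((hg.integrable H.α_pos H.ξ_pos _).const_mul _)
    (integrable_const (iterOp L θ N ω g x)) fun y => H.minorization hω hg x y).trans ?_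
  simp

/-- The iterate is at most `A ^ N` times the maximum of `g`. Integrating `minorization` over `x`,
with `y` a maximum point, bounds that maximum by the mean, since the operators preserve integrals.
-/
theorem integral_majorization (H : NormalizedCocycle G θ S L m α ξ Q s a A N) {ω : Ω} (hω : ω ∈ G)
    {g : X → ℝ} (hg : LogHolder α ξ Q g) (x : X) :
    iterOp L θ N ω g x ≤
      A ^ N / (a ^ N * Real.exp (-(Q * ξ ^ α))) * ∫ y, g y ∂(m ω) := by
  have hc : 0 < a ^ N * Real.exp (-(Q * ξ ^ α)) := mul_pos (pow_pos H.a_pos N) (Real.exp_pos _)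
  have : Nonempty X := ⟨x⟩
  obtain ⟨y, -, hy⟩ := isCompact_univ.exists_isMaxOn Set.univ_nonempty
    (hg.continuous H.α_pos H.ξ_pos).continuousOn
  have h1 := H.upper_iterOp hω (hg.nonneg y) (fun z => hy (Set.mem_univ z)) N x
  have h2 : a ^ N * Real.exp (-(Q * ξ ^ α)) * g y ≤ ∫ z, g z ∂(m ω) := by
    have := H.prob _ (H.iterate_mem hω N)
    rw [← H.integral_iterOp hω hg N]
    refine le_trans (by simp) (integral_mono (μ := m (θ^[N] ω)) (integrable_const _)
      ((H.logHolder_iterOp hω hg N).integrable H.α_pos H.ξ_pos _)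
      fun z => H.minorization hω hg z y)
  refine h1.trans ?_
  rw [div_mul_eq_mul_div, mul_div_assoc]
  refine mul_le_mul_of_nonneg_left ?_ (pow_nonneg H.A_nonneg N)
  rw [le_div_iff₀ hc, mul_comm]
  exact h2

/-- Uniform bounds and exponential loss of memory of the iterates on the cone. -/
theorem exists_loss_of_memory (H : NormalizedCocycle G θ S L m α ξ Q s a A N) :
    ∃ c B r : ℝ, 0 < c ∧ 0 ≤ B ∧ 0 ≤ r ∧ r < 1 ∧
      (∀ ω ∈ G, ∀ g, LogHolder α ξ Q g → ∀ n, N ≤ n → ∀ x,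
        c * ∫ y, g y ∂(m ω) ≤ iterOp L θ n ω g x ∧
          iterOp L θ n ω g x ≤ B * ∫ y, g y ∂(m ω)) ∧
      ∀ k, ∀ ω ∈ G, ∀ f g, LogHolder α ξ Q f → LogHolder α ξ Q g →
        ∫ y, f y ∂(m ω) = ∫ y, g y ∂(m ω) → ∀ n, (k + 1) * N ≤ n → ∀ x,
          |iterOp L θ n ω f x - iterOp L θ n ω g x| ≤ B * r ^ k * ∫ y, f y ∂(m ω) := by
  obtain hG | ⟨ω₀, hω₀⟩ := G.eq_empty_or_nonempty
  · subst hG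
    exact ⟨1, 0, 0, by simp⟩
  set c := a ^ N * Real.exp (-(Q * ξ ^ α)) with hcdef
  have hc : 0 < c := mul_pos (pow_pos H.a_pos N) (Real.exp_pos _)
  -- Integrating the minorization of the constant `1` gives `c ≤ 1`; this makes the rate `1 - (1 -
  -- s) * c` nonnegative.
  have hc1 : c ≤ 1 := by
    have := H.prob ω₀ hω₀
    obtain ⟨x₀⟩ := (m ω₀).nonempty_of_neZero
    have h1 := H.logHolder_iterOp hω₀ (LogHolder.const H.Q_pos.le zero_le_one) N
    have := H.prob _ (H.iterate_mem hω₀ N)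
    have h2 := integral_mono (μ := m (θ^[N] ω₀)) (integrable_const c)
      (h1.integrable H.α_pos H.ξ_pos _) fun x => by
        simpa using H.minorization hω₀ (LogHolder.const H.Q_pos.le zero_le_one) x x₀
    rw [H.integral_iterOp hω₀ (LogHolder.const H.Q_pos.le zero_le_one) N] at h2
    simpa using h2
  set B := A ^ N / c
  have hB : 0 ≤ B := div_nonneg (pow_nonneg H.A_nonneg N) hc.le
  have hbd : ∀ ω ∈ G, ∀ g, LogHolder α ξ Q g → ∀ n, N ≤ n → ∀ x,
      c * ∫ y, g y ∂(m ω) ≤ iterOp L θ n ω g x ∧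
        iterOp L θ n ω g x ≤ B * ∫ y, g y ∂(m ω) := by
    intro ω hω g hg n hn x
    obtain ⟨p, rfl⟩ := Nat.exists_eq_add_of_le' hn
    rw [iterOp_add, ← H.integral_iterOp hω hg p]
    exact ⟨H.integral_minorization (H.iterate_mem hω p) (H.logHolder_iterOp hω hg p) x,
      H.integral_majorization (H.iterate_mem hω p) (H.logHolder_iterOp hω hg p) x⟩
  have hs0 : 0 < 1 - s := sub_pos.2 H.s_lt_one
  -- Doeblin splitting: the removed constant depends only on the mean of `f`, and the remainder is
  -- again in the cone with its mean reduced by the rate.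
  have hstep : ∀ ω ∈ G, ∀ f, LogHolder α ξ Q f → ∃ f', LogHolder α ξ Q f' ∧
      ∫ y, f' y ∂(m (θ^[N] ω)) = (1 - (1 - s) * c) * ∫ y, f y ∂(m ω) ∧
      iterOp L θ N ω f = fun x => (1 - s) * c * ∫ y, f y ∂(m ω) + f' x := by
    intro ω hω f hf
    have := H.prob _ (H.iterate_mem hω N)
    refine ⟨fun x => iterOp L θ N ω f x - (1 - s) * c * ∫ y, f y ∂(m ω), ?_, ?_, ?_⟩
    · refine LogHolder.sub_const ?_ H.Q_pos.le H.s_nonneg H.s_lt_one.le fun x => ?_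
      -- Since `N ≥ 1`, the last operator applied supplies the improved constant `s * Q`.
      · obtain ⟨n, hn⟩ := Nat.exists_eq_succ_of_ne_zero H.N_pos.ne'
        rw [hn]
        exact H.logHolder _ (H.iterate_mem hω n) _ (H.logHolder_iterOp hω hf n)
      · rw [mul_assoc]
        exact mul_le_mul_of_nonneg_left (H.integral_minorization hω hf x) hs0.le
    · rw [integral_sub ((H.logHolder_iterOp hω hf N).integrable H.α_pos H.ξ_pos _)
        (integrable_const _), H.integral_iterOp hω hf N]
      simp
      ring
    · ext x; ring
  refine ⟨c, B, 1 - (1 - s) * c, hc, hB, ?_, ?_, hbd, fun k => ?_⟩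
  · nlinarith [H.s_nonneg]
  · nlinarith
  · induction k with
    | zero =>
      intro ω hω f g hf hg hfg n hn x
      have h1 := hbd ω hω f hf n (by simpa using hn) x
      have h2 := hbd ω hω g hg n (by simpa using hn) x
      have h3 := H.iterOp_nonneg hω hf.nonneg n x
      have h4 := H.iterOp_nonneg hω hg.nonneg n x
      rw [← hfg] at h2
      rw [pow_zero, mul_one, abs_le]
      constructor <;> linarith
    | succ k ih =>
      intro ω hω f g hf hg hfg n hn x
      obtain ⟨p, rfl⟩ : ∃ p, n = N + p := Nat.exists_eq_add_of_le
        (le_trans (Nat.le_mul_of_pos_left N (Nat.succ_pos _)) hn)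
      have hp : (k + 1) * N ≤ p := by nlinarith
      obtain ⟨f', hf', hif, hf1⟩ := hstep ω hω f hf
      obtain ⟨g', hg', hig, hg1⟩ := hstep ω hω g hg
      have hωN := H.iterate_mem hω N
      have := ih _ hωN f' g' hf' hg' (by rw [hif, hig, hfg]) p hp x
      -- Equal means give equal removed constants, whose further iterates cancel in the difference.
      rw [iterOp_add, iterOp_add, hf1, hg1, H.iterOp_plus hωN, H.iterOp_plus hωN, hfg]
      rw [hif, hfg] at this
      simp only [add_sub_add_left_eq_sub]
      refine this.trans_eq ?_
      ring

end NormalizedCocycle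

open Filter Topology

/-! ### Consequences of loss of memory: invariant functions, uniqueness, positivity -/

namespace NormalizedCocycle

variable {Ω X : Type*} [MetricSpace X] [MeasurableSpace X]
  {G : Set Ω} {θ : Ω → Ω} {S : Ω → X → X} {L : Ω → (X → ℝ) → X → ℝ} {m : Ω → Measure X}
  {α ξ Q s a A : ℝ} {N : ℕ}

theorem tendsto_apply (H : NormalizedCocycle G θ S L m α ξ Q s a A N) {ω : Ω} (hω : ω ∈ G)
    {u : ℕ → X → ℝ} {g : X → ℝ} {b : ℕ → ℝ} (hb : Tendsto b atTop (𝓝 0))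
    (hu : ∀ n x, |u n x - g x| ≤ b n) (x : X) :
    Tendsto (fun n => L ω (u n) x) atTop (𝓝 (L ω g x)) := by
  have hb0 : ∀ n, 0 ≤ b n := fun n => (abs_nonneg _).trans (hu n x)
  rw [tendsto_iff_norm_sub_tendsto_zero]
  refine squeeze_zero (fun _ => norm_nonneg _) (fun n => ?_) (by simpa using hb.const_mul A)
  rw [Real.norm_eq_abs, abs_le]
  have h1 := H.upper_of_le hω (hb0 n) (fun y => (abs_le.1 (hu n y)).2) x
  have h2 := H.upper_of_le hω (g := fun y => g y - u n y) (hb0 n)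
    (fun y => by linarith [(abs_le.1 (hu n y)).1]) x
  rw [H.sub_apply hω] at h1 h2
  constructor <;> linarith

variable [CompactSpace X] [BorelSpace X]

/-- For `n ≥ N`, the exponent `k = n / N - 1` is the largest with `(k + 1) * N ≤ n`: one block of
`N` steps is spent on the uniform bounds. -/
theorem tendsto_geometric_div {B r : ℝ} (hr0 : 0 ≤ r) (hr1 : r < 1) (hN : 0 < N) :
    Tendsto (fun n : ℕ => B * r ^ (n / N - 1)) atTop (𝓝 0) := by
  have h : Tendsto (fun n : ℕ => n / N - 1) atTop atTop := by
    refine tendsto_atTop.2 fun b => eventually_atTop.2 ⟨(b + 1) * N, fun n hn => ?_⟩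
    have := (Nat.le_div_iff_mul_le hN).2 hn
    omega
  simpa using ((tendsto_pow_atTop_nhds_zero_of_lt_one hr0 hr1).comp h).const_mul B

/-- The normalised cocycle has an invariant family of functions, the uniform limit of the
pulled-back iterates of the constant function `1`. -/
theorem exists_invariant (H : NormalizedCocycle G θ S L m α ξ Q s a A N) {θi : Ω → Ω}
    (hθ : Function.LeftInverse θ θi) (hθ' : Function.LeftInverse θi θ)
    (hmaps : ∀ ω ∈ G, θi ω ∈ G) :
    ∃ c B : ℝ, 0 < c ∧ ∃ b : ℕ → ℝ, Tendsto b atTop (𝓝 0) ∧ ∃ h : Ω → X → ℝ,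
      ∀ ω ∈ G, LogHolder α ξ Q (h ω) ∧ (∀ x, c ≤ h ω x ∧ h ω x ≤ B) ∧
        (∀ n x, N ≤ n → |pullbackOne L θi n ω x - h ω x| ≤ b n) ∧
        (∀ x, L ω (h ω) x = h (θ ω) x) ∧ ∫ x, h ω x ∂(m ω) = 1 := by
  obtain ⟨c, B, r, hc, hB, hr0, hr1, hbd, hmem⟩ := H.exists_loss_of_memory
  have hone : LogHolder α ξ Q (fun _ : X => (1 : ℝ)) := LogHolder.const H.Q_pos.le zero_le_one
  have hb := tendsto_geometric_div (B := B) hr0 hr1 H.N_pos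
  set b : ℕ → ℝ := fun n => B * r ^ (n / N - 1)
  have hit : ∀ n, ∀ ω ∈ G, θi^[n] ω ∈ G := by
    intro n
    induction n with
    | zero => exact fun ω h => h
    | succ n ih => exact fun ω h => ih _ (hmaps ω h)
  have hint1 : ∀ ω ∈ G, ∫ _, (1 : ℝ) ∂(m ω) = 1 := fun ω hω => by
    have := H.prob ω hω
    simp
  have hcone : ∀ n, ∀ ω ∈ G, LogHolder α ξ Q (pullbackOne L θi n ω) := by
    intro n ω hω
    rw [pullbackOne_eq_iterOp L hθ]
    exact H.logHolder_iterOp (hit n ω hω) hone n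
  have hint : ∀ n, ∀ ω ∈ G, ∫ x, pullbackOne L θi n ω x ∂(m ω) = 1 := by
    intro n ω hω
    have h := H.integral_iterOp (hit n ω hω) hone n
    rw [hθ.iterate n] at h
    rw [pullbackOne_eq_iterOp L hθ, h, hint1 _ (hit n ω hω)]
  have hbounds : ∀ n, N ≤ n → ∀ ω ∈ G, ∀ x,
      c ≤ pullbackOne L θi n ω x ∧ pullbackOne L θi n ω x ≤ B := by
    intro n hn ω hω x
    have h := hbd _ (hit n ω hω) _ hone n hn x
    rw [hint1 _ (hit n ω hω), mul_one, mul_one] at h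
    rwa [pullbackOne_eq_iterOp L hθ]
  have hcauchy : ∀ n, N ≤ n → ∀ p, n ≤ p → ∀ ω ∈ G, ∀ x,
      |pullbackOne L θi p ω x - pullbackOne L θi n ω x| ≤ b n := by
    intro n hn p hp ω hω x
    obtain ⟨q, rfl⟩ := Nat.exists_eq_add_of_le' hp
    -- Both pullbacks are `n`-fold iterates from the same base point, one of the `q`-th pullback and
    -- one of `1`, and both initial functions have mean `1`.
    have h2 : pullbackOne L θi (q + n) ω =
        iterOp L θ n (θi^[n] ω) (pullbackOne L θi q (θi^[n] ω)) := by
      rw [pullbackOne_eq_iterOp L hθ, pullbackOne_eq_iterOp L hθ, iterOp_add,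
        Function.iterate_add_apply, hθ.iterate q]
    rw [h2, pullbackOne_eq_iterOp L hθ n]
    have hn' : 1 ≤ n / N := (Nat.one_le_div_iff H.N_pos).2 hn
    have := hmem (n / N - 1) _ (hit n ω hω) _ _ (hcone q _ (hit n ω hω)) hone
      (by rw [hint q _ (hit n ω hω), hint1 _ (hit n ω hω)]) n
      (by rw [Nat.sub_add_cancel hn']; exact Nat.div_mul_le_self n N) x
    rwa [hint q _ (hit n ω hω), mul_one] at this
  have hlim : ∀ ω ∈ G, ∀ x, ∃ l, Tendsto (fun n => pullbackOne L θi n ω x) atTop (𝓝 l) := by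
    intro ω hω x
    refine cauchySeq_tendsto_of_complete (Metric.cauchySeq_iff'.2 fun ε hε => ?_)
    obtain ⟨n, hn, hnN⟩ := ((hb.eventually (gt_mem_nhds hε)).and (eventually_ge_atTop N)).exists
    exact ⟨n, fun p hp => (hcauchy n hnN p hp ω hω x).trans_lt hn⟩
  choose! h hh using hlim
  have hconv : ∀ ω ∈ G, ∀ n x, N ≤ n → |pullbackOne L θi n ω x - h ω x| ≤ b n := by
    intro ω hω n x hn
    rw [abs_sub_comm]
    exact le_of_tendsto ((hh ω hω x).sub_const _).abs
      (eventually_atTop.2 ⟨n, fun p hp => hcauchy n hn p hp ω hω x⟩)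
  have hhb : ∀ ω ∈ G, ∀ x, c ≤ h ω x ∧ h ω x ≤ B := fun ω hω x =>
    ⟨ge_of_tendsto (hh ω hω x) (eventually_atTop.2 ⟨N, fun n hn => (hbounds n hn ω hω x).1⟩),
      le_of_tendsto (hh ω hω x) (eventually_atTop.2 ⟨N, fun n hn => (hbounds n hn ω hω x).2⟩)⟩
  refine ⟨c, B, hc, b, hb, h, fun ω hω => ⟨?_, hhb ω hω, hconv ω hω, fun x => ?_, ?_⟩⟩
  · exact LogHolder.of_tendsto (fun n => hcone n ω hω) (hh ω hω)
  · refine tendsto_nhds_unique (f := fun n => L ω (pullbackOne L θi (n + N) ω) x) ?_ ?_ (l := atTop)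
    · exact H.tendsto_apply hω ((tendsto_add_atTop_iff_nat N).2 hb)
        (fun n x => hconv ω hω (n + N) x (Nat.le_add_left N n)) x
    · have h1 := (tendsto_add_atTop_iff_nat (N + 1)).2 (hh _ (H.mapsTo ω hω) x)
      refine h1.congr fun n => ?_
      rw [← add_assoc, pullbackOne, hθ' ω]
  · have := H.prob ω hω
    have h1 : Tendsto (fun n => ∫ x, pullbackOne L θi (n + N) ω x ∂(m ω)) atTop
        (𝓝 (∫ x, h ω x ∂(m ω))) := by
      refine tendsto_integral_of_dominated_convergence (fun _ => B)
        (fun n => ((hcone _ ω hω).integrable H.α_pos H.ξ_pos _).aestronglyMeasurable)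
        (integrable_const B) (fun n => Eventually.of_forall fun x => ?_)
        (Eventually.of_forall fun x => (tendsto_add_atTop_iff_nat N).2 (hh ω hω x))
      rw [Real.norm_of_nonneg ((hcone _ ω hω).nonneg x)]
      exact (hbounds _ (Nat.le_add_left N n) ω hω x).2
    simp only [hint _ ω hω] at h1
    exact (tendsto_nhds_unique h1 tendsto_const_nhds)

/-- Conformal measures agree with the normalising ones on the cone. -/
theorem integral_eq_of_conformal (H : NormalizedCocycle G θ S L m α ξ Q s a A N)
    {ν : Ω → Measure X} {κ : Ω → ℝ} (hν : ∀ ω ∈ G, IsProbabilityMeasure (ν ω))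
    (hκ : ∀ ω ∈ G, ∀ g, LogHolder α ξ Q g →
      ∫ x, L ω g x ∂(ν (θ ω)) = κ ω * ∫ x, g x ∂(ν ω))
    {ω : Ω} (hω : ω ∈ G) {f : X → ℝ} (hf : LogHolder α ξ Q f) :
    ∫ x, f x ∂(ν ω) = ∫ x, f x ∂(m ω) := by
  obtain ⟨c, B, r, hc, hB, hr0, hr1, hbd, hmem⟩ := H.exists_loss_of_memory
  have hone : LogHolder α ξ Q (fun _ : X => (1 : ℝ)) := LogHolder.const H.Q_pos.le zero_le_one
  have hb := tendsto_geometric_div (B := B) hr0 hr1 H.N_pos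
  have := hν ω hω
  have := H.prob ω hω
  -- `K` is the product of the `κ` along the orbit; only its independence of `g` matters.
  have hprod : ∀ n : ℕ, ∃ K : ℝ, ∀ g, LogHolder α ξ Q g →
      ∫ x, iterOp L θ n ω g x ∂(ν (θ^[n] ω)) = K * ∫ x, g x ∂(ν ω) := by
    intro n
    induction n with
    | zero => exact ⟨1, fun g _ => (one_mul _).symm⟩
    | succ n ih =>
      obtain ⟨K, hK⟩ := ih
      refine ⟨κ (θ^[n] ω) * K, fun g hg => ?_⟩
      rw [Function.iterate_succ_apply', mul_assoc, ← hK g hg]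
      exact hκ _ (H.iterate_mem hω n) _ (H.logHolder_iterOp hω hg n)
  set I := ∫ x, f x ∂(m ω)
  have hI : 0 ≤ I := integral_nonneg hf.nonneg
  have hIone : LogHolder α ξ Q (fun _ : X => I * 1) := hone.const_mul hI
  have key : ∀ n, N ≤ n →
      c * |∫ x, f x ∂(ν ω) - I| ≤ B * r ^ (n / N - 1) * I := by
    intro n hn
    have := hν _ (H.iterate_mem hω n)
    obtain ⟨K, hK⟩ := hprod n
    -- Testing on `1` shows that `K` is the mean of an iterate of `1`, so it stays away from zero
    -- and cannot absorb the decay of the difference.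
    have hcK : c ≤ K := by
      have h1 := hK _ hone
      rw [integral_const, probReal_univ, smul_eq_mul, mul_one, mul_one] at h1
      rw [← h1]
      refine le_trans (by simp) (integral_mono (μ := ν (θ^[n] ω)) (integrable_const c)
        ((H.logHolder_iterOp hω hone n).integrable H.α_pos H.ξ_pos _) fun x => ?_)
      simpa using (hbd ω hω _ hone n hn x).1
    have hn' : 1 ≤ n / N := (Nat.one_le_div_iff H.N_pos).2 hn
    -- The comparison function for `f` is the constant equal to its `m ω`-mean.
    have hdiff := fun x => hmem (n / N - 1) ω hω _ _ hf hIone (by simp [I]) n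
      (by rw [Nat.sub_add_cancel hn']; exact Nat.div_mul_le_self n N) x
    have h2 : ∫ x, iterOp L θ n ω f x ∂(ν (θ^[n] ω)) -
        ∫ x, iterOp L θ n ω (fun _ => I * 1) x ∂(ν (θ^[n] ω)) = K * (∫ x, f x ∂(ν ω) - I) := by
      rw [hK f hf, hK _ hIone]
      simp
      ring
    rw [← integral_sub ((H.logHolder_iterOp hω hf n).integrable H.α_pos H.ξ_pos _)
      ((H.logHolder_iterOp hω hIone n).integrable H.α_pos H.ξ_pos _)] at h2
    have h3 := norm_integral_le_of_norm_le_const (μ := ν (θ^[n] ω))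
      (f := fun x => iterOp L θ n ω f x - iterOp L θ n ω (fun _ => I * 1) x)
      (Eventually.of_forall hdiff)
    rw [h2, probReal_univ, mul_one, Real.norm_eq_abs, abs_mul,
      abs_of_pos (hc.trans_le hcK)] at h3
    exact (mul_le_mul_of_nonneg_right hcK (abs_nonneg _)).trans h3
  have hlim : c * |∫ x, f x ∂(ν ω) - I| ≤ 0 := by
    have h1 := hb.mul_const I
    rw [zero_mul] at h1
    exact ge_of_tendsto h1 (eventually_atTop.2 ⟨N, key⟩)
  have h0 : |∫ x, f x ∂(ν ω) - I| ≤ 0 := by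
    by_contra hcon
    exact absurd hlim (not_le.2 (mul_pos hc (not_le.1 hcon)))
  exact sub_eq_zero.1 (abs_nonpos_iff.1 h0)

/-- Normalised invariant families of uniformly Hölder functions are uniformly positive. -/
theorem exists_lower_bound_of_invariant (H : NormalizedCocycle G θ S L m α ξ Q s a A N)
    {θi : Ω → Ω} (hθ : Function.LeftInverse θ θi) (hmaps : ∀ ω ∈ G, θi ω ∈ G)
    {h : Ω → X → ℝ} {q : ℝ} (hq : 0 ≤ q) (hcone : ∀ ω ∈ G, LogHolder α ξ Q (fun x => h ω x + q))
    (hint : ∀ ω ∈ G, ∫ x, h ω x ∂(m ω) = 1) (hinv : ∀ ω ∈ G, ∀ x, L ω (h ω) x = h (θ ω) x) :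
    ∃ c : ℝ, 0 < c ∧ ∀ ω ∈ G, ∀ x, c ≤ h ω x := by
  obtain ⟨c, B, r, hc, hB, hr0, hr1, hbd, hmem⟩ := H.exists_loss_of_memory
  have hone : LogHolder α ξ Q (fun _ : X => (1 : ℝ)) := LogHolder.const H.Q_pos.le zero_le_one
  have hb := (tendsto_geometric_div (B := B) hr0 hr1 H.N_pos).mul_const (1 + q)
  rw [zero_mul] at hb
  have hit : ∀ n, ∀ ω ∈ G, θi^[n] ω ∈ G := by
    intro n
    induction n with
    | zero => exact fun ω h => h
    | succ n ih => exact fun ω h => ih _ (hmaps ω h)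
  have hiter : ∀ n, ∀ ω ∈ G, iterOp L θ n ω (h ω) = h (θ^[n] ω) := by
    intro n ω hω
    induction n with
    | zero => rfl
    | succ n ih =>
      rw [iterOp, ih, Function.iterate_succ_apply']
      exact funext (hinv _ (H.iterate_mem hω n))
  refine ⟨c, hc, fun ω hω x => ?_⟩
  -- The iterates of `h + q` and of the constant `1 + q` merge. By invariance the first is `h` plus
  -- `q` times the iterate of `1`; cancelling the `q` terms leaves `h` close to the iterate of `1`,
  -- which is at least `c`.
  have key : ∀ n, N ≤ n → c - B * r ^ (n / N - 1) * (1 + q) ≤ h ω x := by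
    intro n hn
    have hωn := hit n ω hω
    have := H.prob _ hωn
    have hcn := hcone _ hωn
    have hq1 : LogHolder α ξ Q (fun _ : X => (1 + q) * 1) := hone.const_mul (by linarith)
    have hI : ∫ y, (h (θi^[n] ω) y + q) ∂(m (θi^[n] ω)) = 1 + q := by
      have h1 := hcn.integrable H.α_pos H.ξ_pos (m (θi^[n] ω))
      have h2 : Integrable (h (θi^[n] ω)) (m (θi^[n] ω)) := by
        exact (h1.sub (integrable_const q)).congr (Eventually.of_forall fun y => by simp)
      rw [integral_add h2 (integrable_const q), hint _ hωn]
      simp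
    have hn' : 1 ≤ n / N := (Nat.one_le_div_iff H.N_pos).2 hn
    have h3 := hmem (n / N - 1) _ hωn _ _ hcn hq1 (by rw [hI]; simp) n
      (by rw [Nat.sub_add_cancel hn']; exact Nat.div_mul_le_self n N) x
    have hqc : iterOp L θ n (θi^[n] ω) (fun _ => q) x =
        q * iterOp L θ n (θi^[n] ω) (fun _ => 1) x := by
      have := congrFun (H.iterOp_const_mul hωn n q (fun _ => 1)) x
      simpa using this
    rw [hI, H.iterOp_plus hωn, H.iterOp_const_mul hωn, hiter n _ hωn, hθ.iterate n] at h3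
    beta_reduce at h3
    rw [hqc] at h3
    have h4 := (hbd _ hωn _ hone n hn x).1
    simp only [integral_const, probReal_univ, smul_eq_mul, mul_one] at h4
    have h5 := (abs_le.1 h3).1
    linarith
  have hlim := hb.const_sub c
  rw [sub_zero] at hlim
  exact le_of_tendsto hlim (eventually_atTop.2 ⟨N, key⟩)

end NormalizedCocycle

/-! ### The Hölder norm -/

section HolderNorm

variable {X : Type*} [MetricSpace X] {α ξ : ℝ} {g : X → ℝ}

/-- The extra `1` makes the inequality strict, so an admissible `R` can be picked without knowing
that the infimum is attained. -/
theorem bounds_of_holderNorm_le {C : ℝ≥0} (h : holderNorm α ξ g ≤ C) :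
    (∀ x, |g x| ≤ C) ∧
      ∀ x x', dist x x' < ξ → |g x - g x'| ≤ (C + 1 : ℝ) * dist x x' ^ α := by
  constructor
  · intro x
    have h1 : ‖g x‖ₑ ≤ (C : ℝ≥0∞) :=
      (le_iSup (fun x => ‖g x‖ₑ) x).trans (le_self_add.trans h)
    have h2 : ‖g x‖₊ ≤ C := by exact_mod_cast h1
    exact_mod_cast h2
  · have h1 : (⨅ (R : ℝ≥0) (_ : ∀ x x' : X, dist x x' < ξ → |g x - g x'| ≤ R * dist x x' ^ α),
        (R : ℝ≥0∞)) < ((C + 1 : ℝ≥0) : ℝ≥0∞) :=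
      lt_of_le_of_lt (le_add_self.trans h) (by exact_mod_cast lt_add_one C)
    obtain ⟨R, hR⟩ := iInf_lt_iff.1 h1
    obtain ⟨hR1, hR2⟩ := iInf_lt_iff.1 hR
    intro x x' hx
    refine (hR1 x x' hx).trans (mul_le_mul_of_nonneg_right ?_ (Real.rpow_nonneg dist_nonneg _))
    have : R < C + 1 := by exact_mod_cast hR2
    exact_mod_cast this.le

theorem holderNorm_le_of_bounds {M R : ℝ} (hR : 0 ≤ R) (hM : ∀ x, |g x| ≤ M)
    (hg : ∀ x x', dist x x' < ξ → |g x - g x'| ≤ R * dist x x' ^ α) :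
    holderNorm α ξ g ≤ ((M.toNNReal + R.toNNReal : ℝ≥0) : ℝ≥0∞) := by
  rw [ENNReal.coe_add]
  refine add_le_add (iSup_le fun x => ?_) (iInf₂_le R.toNNReal fun x x' hx => ?_)
  · rw [Real.enorm_eq_ofReal_abs]
    exact ENNReal.ofReal_le_ofReal (hM x)
  · rw [Real.coe_toNNReal R hR]
    exact hg x x' hx

/-- The constant comes from `e^z - 1 ≤ z e^z` with `z = Q d^α ≤ Q ξ^α`. -/
theorem LogHolder.abs_sub_le {Q M : ℝ} (hg : LogHolder α ξ Q g) (hα : 0 ≤ α) (hQ : 0 ≤ Q)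
    (hM : ∀ x, g x ≤ M) {x x' : X} (hx : dist x x' < ξ) :
    |g x - g x'| ≤ Q * Real.exp (Q * ξ ^ α) * M * dist x x' ^ α := by
  have key : ∀ x x', dist x x' < ξ →
      g x - g x' ≤ Q * Real.exp (Q * ξ ^ α) * M * dist x x' ^ α := by
    intro x x' hx
    have hd : 0 ≤ dist x x' ^ α := Real.rpow_nonneg dist_nonneg _
    have hz : 0 ≤ Q * dist x x' ^ α := mul_nonneg hQ hd
    have h1 := hg.le_exp_mul x x' hx
    have h2 : Real.exp (Q * dist x x' ^ α) ≤ Real.exp (Q * ξ ^ α) := Real.exp_le_exp.2 <|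
      mul_le_mul_of_nonneg_left (Real.rpow_le_rpow dist_nonneg hx.le hα) hQ
    set z := Q * dist x x' ^ α
    have h3 : Real.exp z - 1 ≤ z * Real.exp z := by
      have h4 := mul_le_mul_of_nonneg_right (Real.one_sub_le_exp_neg z) (Real.exp_pos z).le
      rw [← Real.exp_add, neg_add_cancel, Real.exp_zero] at h4
      linarith
    have h0 := hg.nonneg x'
    calc g x - g x' ≤ (Real.exp z - 1) * g x' := by linarith
      _ ≤ (z * Real.exp (Q * ξ ^ α)) * M :=
        mul_le_mul (h3.trans (mul_le_mul_of_nonneg_left h2 hz)) (hM x') h0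
          (mul_nonneg hz (Real.exp_pos _).le)
      _ = _ := by simp only [z]; ring
  rw [abs_le]
  have h := key x' x (by rwa [dist_comm])
  rw [dist_comm] at h
  exact ⟨by linarith, key x x' hx⟩

theorem LogHolder.holderNorm_le {Q M : ℝ} (hg : LogHolder α ξ Q g) (hα : 0 ≤ α) (hQ : 0 ≤ Q)
    (hM0 : 0 ≤ M) (hM : ∀ x, g x ≤ M) :
    holderNorm α ξ g ≤
      ((M.toNNReal + (Q * Real.exp (Q * ξ ^ α) * M).toNNReal : ℝ≥0) : ℝ≥0∞) :=
  holderNorm_le_of_bounds (by positivity)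
    (fun x => by rw [abs_of_nonneg (hg.nonneg x)]; exact hM x)
    fun _ _ hx => hg.abs_sub_le hα hQ hM hx

theorem LogHolder.holderNorm_lt_top [CompactSpace X] {Q : ℝ} (hg : LogHolder α ξ Q g)
    (hα : 0 < α) (hξ : 0 < ξ) (hQ : 0 ≤ Q) : holderNorm α ξ g < ∞ := by
  obtain ⟨M, hM⟩ := isCompact_univ.bddAbove_image (hg.continuous hα hξ).continuousOn
  have hM' : ∀ x, g x ≤ max M 0 := fun x =>
    (hM (Set.mem_image_of_mem g (Set.mem_univ x))).trans (le_max_left _ _)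
  exact (hg.holderNorm_le hα.le hQ (le_max_right _ _) hM').trans_lt ENNReal.coe_lt_top

end HolderNorm

/-! ### Transfer operators of maps with paired fibres -/

/-- The fibres of `S` over `ξ`-close points have at most `D` elements and are paired by a
contraction with factor `τ`. -/
def PairedFibers {X : Type*} [MetricSpace X] (S : X → X) (ξ τ D : ℝ) : Prop :=
  ∀ x x' : X, dist x x' < ξ → ∃ (k : ℕ) (y y' : Fin k → X), (k : ℝ) ≤ D ∧
    Function.Injective y ∧ Function.Injective y' ∧
    Set.range y = S ⁻¹' {x} ∧ Set.range y' = S ⁻¹' {x'} ∧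
    ∀ i, dist (y i) (y' i) ≤ τ * dist x x'

theorem transferOp_eq_sum {X : Type*} [MetricSpace X] {S : X → X} (f g : X → ℝ) {x : X} {k : ℕ}
    {y : Fin k → X} (hy : Function.Injective y) (hr : Set.range y = S ⁻¹' {x}) :
    transferOp S f g x = ∑ i, Real.exp (f (y i)) * g (y i) := by
  rw [transferOp, ← hr, finsum_mem_range hy, finsum_eq_sum_of_fintype]

namespace PairedFibers

variable {X : Type*} [MetricSpace X] {S : X → X} {ξ τ D : ℝ}

theorem exists_enum (h : PairedFibers S ξ τ D) (hξ : 0 < ξ) (x : X) :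
    ∃ (k : ℕ) (y : Fin k → X), (k : ℝ) ≤ D ∧ Function.Injective y ∧
      Set.range y = S ⁻¹' {x} := by
  obtain ⟨k, y, -, hk, hy, -, hr, -⟩ := h x x (by simpa using hξ)
  exact ⟨k, y, hk, hy, hr⟩

theorem finite_fiber (h : PairedFibers S ξ τ D) (hξ : 0 < ξ) (x : X) : (S ⁻¹' {x}).Finite := by
  obtain ⟨k, y, -, -, hr⟩ := h.exists_enum hξ x
  exact hr ▸ Set.finite_range y

theorem transferOp_add (h : PairedFibers S ξ τ D) (hξ : 0 < ξ) (f g₁ g₂ : X → ℝ) (x : X) :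
    transferOp S f (fun x => g₁ x + g₂ x) x = transferOp S f g₁ x + transferOp S f g₂ x := by
  obtain ⟨k, y, -, hy, hr⟩ := h.exists_enum hξ x
  simp only [transferOp_eq_sum f _ hy hr, mul_add, Finset.sum_add_distrib]

theorem transferOp_const_mul (h : PairedFibers S ξ τ D) (hξ : 0 < ξ) (f g : X → ℝ) (c : ℝ)
    (x : X) : transferOp S f (fun x => c * g x) x = c * transferOp S f g x := by
  obtain ⟨k, y, -, hy, hr⟩ := h.exists_enum hξ x
  simp only [transferOp_eq_sum f _ hy hr, Finset.mul_sum]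
  exact Finset.sum_congr rfl fun i _ => by ring

theorem le_transferOp (h : PairedFibers S ξ τ D) (hξ : 0 < ξ) (f : X → ℝ) {g : X → ℝ}
    (hg : ∀ x, 0 ≤ g x) (z : X) : Real.exp (f z) * g z ≤ transferOp S f g (S z) := by
  obtain ⟨k, y, -, hy, hr⟩ := h.exists_enum hξ (S z)
  obtain ⟨i, hi⟩ : z ∈ Set.range y := by rw [hr]; rfl
  rw [transferOp_eq_sum f _ hy hr, ← hi]
  exact Finset.single_le_sum (f := fun i => Real.exp (f (y i)) * g (y i))
    (fun j _ => mul_nonneg (Real.exp_pos _).le (hg _)) (Finset.mem_univ i)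

theorem transferOp_one_le (h : PairedFibers S ξ τ D) (hξ : 0 < ξ) {f : X → ℝ} {C : ℝ}
    (hf : ∀ x, f x ≤ C) (x : X) : transferOp S f (fun _ => 1) x ≤ D * Real.exp C := by
  obtain ⟨k, y, hk, hy, hr⟩ := h.exists_enum hξ x
  rw [transferOp_eq_sum f _ hy hr]
  refine (Finset.sum_le_card_nsmul _ _ (Real.exp C) fun i _ => ?_).trans ?_
  · rw [mul_one]; exact Real.exp_le_exp.2 (hf _)
  · simpa using mul_le_mul_of_nonneg_right hk (Real.exp_pos C).le

/-- The two sums are compared term by term along the pairing. The weight contributes `R` and the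
function `Q`, both at distance at most `τ d`, hence the common factor `τ ^ α`. -/
theorem logHolder_transferOp (h : PairedFibers S ξ τ D) (hξ : 0 < ξ) (hτ0 : 0 ≤ τ) (hτ1 : τ ≤ 1)
    {α R Q : ℝ} (hα : 0 ≤ α) (hR : 0 ≤ R) (hQ : 0 ≤ Q) {f g : X → ℝ}
    (hf : ∀ x x', dist x x' < ξ → |f x - f x'| ≤ R * dist x x' ^ α) (hg : LogHolder α ξ Q g) :
    LogHolder α ξ ((R + Q) * τ ^ α) (transferOp S f g) := by
  constructor
  · intro x
    obtain ⟨k, y, -, hy, hr⟩ := h.exists_enum hξ x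
    rw [transferOp_eq_sum f _ hy hr]
    exact Finset.sum_nonneg fun i _ => mul_nonneg (Real.exp_pos _).le (hg.nonneg _)
  · intro x x' hx
    obtain ⟨k, y, y', -, hy, hy', hr, hr', hd⟩ := h x x' hx
    rw [transferOp_eq_sum f _ hy hr, transferOp_eq_sum f _ hy' hr', Finset.mul_sum]
    refine Finset.sum_le_sum fun i _ => ?_
    have hlt : dist (y i) (y' i) < ξ :=
      ((hd i).trans (mul_le_of_le_one_left dist_nonneg hτ1)).trans_lt hx
    have hpow : dist (y i) (y' i) ^ α ≤ τ ^ α * dist x x' ^ α := by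
      rw [← Real.mul_rpow hτ0 dist_nonneg]
      exact Real.rpow_le_rpow dist_nonneg (hd i) hα
    have h1 := (le_abs_self _).trans (hf _ _ hlt)
    calc Real.exp (f (y i)) * g (y i)
        ≤ Real.exp (f (y i)) * (Real.exp (Q * dist (y i) (y' i) ^ α) * g (y' i)) :=
          mul_le_mul_of_nonneg_left (hg.le_exp_mul _ _ hlt) (Real.exp_pos _).le
      _ = Real.exp (f (y i) + Q * dist (y i) (y' i) ^ α) * g (y' i) := by
          rw [Real.exp_add, mul_assoc]
      _ ≤ Real.exp ((R + Q) * τ ^ α * dist x x' ^ α + f (y' i)) * g (y' i) := by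
          refine mul_le_mul_of_nonneg_right (Real.exp_le_exp.2 ?_) (hg.nonneg _)
          have := mul_le_mul_of_nonneg_left hpow (add_nonneg hR hQ)
          linarith
      _ = _ := by rw [Real.exp_add, mul_assoc]

end PairedFibers

/-! ### Conformal families -/

/-- `(lam ω, ν ω)` is a family of eigenvalues and dual eigenmeasures of the transfer operators. -/
structure IsConformal {Ω X : Type*} [MeasurableSpace Ω] [MetricSpace X] [MeasurableSpace X]
    (P : Measure Ω) (θ : Ω → Ω) (T : Ω → X → X) (α ξ : ℝ) (φ : Ω → X → ℝ)
    (lam : Ω → ℝ) (ν : Ω → Measure X) : Prop where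
  measurable_lam : Measurable lam
  measurable_ν : Measurable ν
  lam_pos : ∀ᵐ ω ∂P, 0 < lam ω
  prob : ∀ᵐ ω ∂P, IsProbabilityMeasure (ν ω)
  eigenmeasure : ∀ᵐ ω ∂P, ∀ g : X → ℝ, holderNorm α ξ g < ∞ →
    ∫ x, transferOp (T ω) (φ ω) g x ∂(ν (θ ω)) = lam ω * ∫ x, g x ∂(ν ω)

theorem IsRPFTriplet.isConformal {Ω X : Type*} [MeasurableSpace Ω] [MetricSpace X]
    [MeasurableSpace X] {P : Measure Ω} {θ : Ω → Ω} {T : Ω → X → X} {α ξ : ℝ} {φ : Ω → X → ℝ}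
    {lam : Ω → ℝ} {h : Ω → X → ℝ} {ν : Ω → Measure X}
    (H : IsRPFTriplet P θ T α ξ φ lam h ν) : IsConformal P θ T α ξ φ lam ν :=
  ⟨H.measurable_lam, H.measurable_ν, H.lam_pos, H.prob, H.eigenmeasure⟩

/-- The transfer operators divided by their eigenvalues. -/
noncomputable def normalizedOp {Ω X : Type*} [MetricSpace X] (T : Ω → X → X) (φ : Ω → X → ℝ)
    (lam : Ω → ℝ) (ω : Ω) (g : X → ℝ) (x : X) : ℝ :=
  (lam ω)⁻¹ * transferOp (T ω) (φ ω) g x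

theorem fiberIterate_image_eq_univ {Ω X : Type*} {θ : Ω → Ω} {T : Ω → X → X}
    (hT : ∀ ω, Function.Surjective (T ω)) {ω : Ω} {s : Set X} {n k : ℕ} (hnk : n ≤ k)
    (h : fiberIterate θ T n ω '' s = Set.univ) : fiberIterate θ T k ω '' s = Set.univ := by
  induction k, hnk using Nat.le_induction with
  | base => exact h
  | succ k _ ih =>
    have : fiberIterate θ T (k + 1) ω = T (θ^[k] ω) ∘ fiberIterate θ T k ω := rfl
    rw [this, Set.image_comp, ih, Set.image_univ, (hT _).range_eq]

/-! ### Uniform constants and the invariant set of full measure -/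

section Cocycle

variable {Ω X : Type*} [MeasurableSpace Ω] [MetricSpace X] [MeasurableSpace X]
  {P : Measure Ω} {T : Ω → X → X} {ξ α : ℝ} {φ : Ω → X → ℝ} {lam : Ω → ℝ} {ν : Ω → Measure X}

theorem IsRandomExpanding.exists_pairedFibers {θ : Ω → Ω} (hT : IsRandomExpanding P θ T ξ) :
    ∃ τ D : ℝ, 0 ≤ τ ∧ τ < 1 ∧ 0 ≤ D ∧ ∀ᵐ ω ∂P, PairedFibers (T ω) ξ τ D := by
  obtain ⟨γ, D, -, -, ⟨δ, hδ, hγ⟩, ⟨C, hC⟩, h⟩ := hT.pairing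
  refine ⟨(1 + δ)⁻¹, max C 0, by positivity, inv_lt_one_of_one_lt₀ (by linarith),
    le_max_right _ _, ?_⟩
  filter_upwards [hγ, hC, h] with ω h1 h2 h3 x x' hx
  obtain ⟨k, y, y', hk, hy, hy', hr, hr', hd⟩ := h3 x x' hx
  refine ⟨k, y, y', (hk.trans h2).trans (le_max_left _ _), hy, hy', hr, hr', fun i =>
    (hd i).trans (mul_le_mul_of_nonneg_right ?_ dist_nonneg)⟩
  exact inv_anti₀ (by linarith) h1

/-- Surjectivity lets covering persist at later times, so a bound for `n_ω` serves all `ω`; adding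
`1` makes it positive. -/
theorem IsRandomExpanding.exists_exact {θ : Ω → Ω} (hT : IsRandomExpanding P θ T ξ) :
    ∃ N : ℕ, 0 < N ∧ ∀ᵐ ω ∂P, ∀ x, fiberIterate θ T N ω '' Metric.ball x ξ = Set.univ := by
  obtain ⟨n, -, ⟨N, hN⟩, h⟩ := hT.exact
  refine ⟨N + 1, Nat.succ_pos N, ?_⟩
  filter_upwards [hN, h] with ω h1 h2 x
  exact fiberIterate_image_eq_univ hT.surjective (h1.trans N.le_succ) (h2 x)

/-- A full measure set on which a given property holds can be made invariant. -/
theorem exists_invariant_subset {θ : Ω ≃ᵐ Ω} (hθ : MeasurePreserving θ P P) {p : Ω → Prop}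
    (hp : ∀ᵐ ω ∂P, p ω) :
    ∃ G : Set Ω, (∀ᵐ ω ∂P, ω ∈ G) ∧ (∀ ω ∈ G, p ω) ∧ (∀ ω ∈ G, θ ω ∈ G) ∧
      ∀ ω ∈ G, θ.symm ω ∈ G := by
  refine ⟨{ω | ∀ n : ℕ, p (θ^[n] ω) ∧ p (θ.symm^[n] ω)}, ?_, fun ω hω => (hω 0).1,
    fun ω hω n => ⟨(hω (n + 1)).1, ?_⟩, fun ω hω n => ⟨?_, (hω (n + 1)).2⟩⟩
  · refine ae_all_iff.2 fun n => ?_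
    have h1 := (hθ.quasiMeasurePreserving.iterate n).ae hp
    have h2 := ((hθ.symm θ).quasiMeasurePreserving.iterate n).ae hp
    filter_upwards [h1, h2] with ω h1 h2 using ⟨h1, h2⟩
  · cases n with
    | zero => exact (hω 1).1
    | succ n =>
      rw [Function.iterate_succ_apply, θ.symm_apply_apply]
      exact (hω n).2
  · cases n with
    | zero => exact (hω 1).2
    | succ n =>
      rw [Function.iterate_succ_apply, θ.apply_symm_apply]
      exact (hω n).1

variable [CompactSpace X] [BorelSpace X]

/-- The transfer operators, normalised by the eigenvalues of a conformal family, form a normalised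
cocycle over an invariant set of full measure. -/
theorem IsConformal.exists_normalizedCocycle {θ : Ω ≃ᵐ Ω} (hθ : MeasurePreserving θ P P)
    (hT : IsRandomExpanding P θ T ξ) (hα : 0 < α) (hφ : IsPotential P T α ξ φ)
    (H : IsConformal P θ T α ξ φ lam ν) {p : Ω → Prop} (hp : ∀ᵐ ω ∂P, p ω) :
    ∃ (G : Set Ω) (Q s a A : ℝ) (N : ℕ) (Λ : ℝ≥0), (∀ᵐ ω ∂P, ω ∈ G) ∧ (∀ ω ∈ G, p ω) ∧
      (∀ ω ∈ G, θ.symm ω ∈ G) ∧ (∀ ω ∈ G, 0 < lam ω ∧ lam ω ≤ Λ) ∧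
      (∀ ω ∈ G, ∀ g : X → ℝ, holderNorm α ξ g < ∞ →
        ∫ x, transferOp (T ω) (φ ω) g x ∂(ν (θ ω)) = lam ω * ∫ x, g x ∂(ν ω)) ∧
      NormalizedCocycle G θ T (normalizedOp T φ lam) ν α ξ Q s a A N := by
  obtain ⟨τ, D, hτ0, hτ1, hD, hpair⟩ := hT.exists_pairedFibers
  obtain ⟨N, hN, hex⟩ := hT.exists_exact
  obtain ⟨C, hC⟩ := hφ.bounded
  obtain ⟨G, hG, hGp, hGθ, hGi⟩ := exists_invariant_subset hθ
    (hp.and (hpair.and (hex.and (hC.and (H.lam_pos.and (H.prob.and H.eigenmeasure))))))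
  have hξ := hT.pos
  set σ := τ ^ α
  have hσ0 : 0 ≤ σ := Real.rpow_nonneg hτ0 α
  have hσ1 : σ < 1 := Real.rpow_lt_one hτ0 hτ1 hα
  set R : ℝ := C + 1
  have hR : 0 ≤ R := by positivity
  -- Any `s` strictly between `σ` and `1` would do. `Q` is then taken large enough for `(R + Q) * σ
  -- ≤ s * Q`; its `+ 1` keeps it positive even if `σ = 0`.
  set s := (1 + σ) / 2 with hs
  have hsσ : 0 < s - σ := by rw [hs]; linarith
  set Q := R * σ / (s - σ) + 1 with hQdef
  have hQ : 0 < Q := by positivity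
  have hQs : (R + Q) * σ ≤ s * Q := by
    have : R * σ / (s - σ) * (s - σ) = R * σ := div_mul_cancel₀ _ hsσ.ne'
    have : Q * (s - σ) = R * σ + (s - σ) := by rw [hQdef, add_mul, this, one_mul]
    nlinarith
  have hone : LogHolder α ξ Q (fun _ : X => (1 : ℝ)) := LogHolder.const hQ.le zero_le_one
  have hbound : ∀ ω ∈ G, ∀ x, |φ ω x| ≤ C := fun ω hω =>
    (bounds_of_holderNorm_le (hGp ω hω).2.2.2.1).1
  have hcone : ∀ ω ∈ G, ∀ g, LogHolder α ξ Q g →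
      LogHolder α ξ (s * Q) (transferOp (T ω) (φ ω) g) := fun ω hω g hg =>
    ((hGp ω hω).2.1.logHolder_transferOp hξ hτ0 hτ1.le hα.le hR hQ.le
      (bounds_of_holderNorm_le (hGp ω hω).2.2.2.1).2 hg).mono hQs
  have hlow : ∀ ω ∈ G, ∀ g : X → ℝ, (∀ x, 0 ≤ g x) → ∀ x,
      Real.exp (-C) * g x ≤ transferOp (T ω) (φ ω) g (T ω x) := fun ω hω g hg x =>
    (mul_le_mul_of_nonneg_right (Real.exp_le_exp.2 (abs_le.1 (hbound ω hω x)).1) (hg x)).trans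
      ((hGp ω hω).2.1.le_transferOp hξ _ hg x)
  have hup : ∀ ω ∈ G, ∀ x, transferOp (T ω) (φ ω) (fun _ => 1) x ≤ D * Real.exp C :=
    fun ω hω x => (hGp ω hω).2.1.transferOp_one_le hξ (fun x => (abs_le.1 (hbound ω hω x)).2) x
  have hpos : ∀ ω ∈ G, 0 < lam ω := fun ω hω => (hGp ω hω).2.2.2.2.1
  -- The eigenvalue is the `ν (θ ω)`-mean of the transfer operator applied to `1`, so pointwise
  -- bounds for that function apply.
  have hlam : ∀ ω ∈ G, Real.exp (-C) ≤ lam ω ∧ lam ω ≤ D * Real.exp C := by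
    intro ω hω
    have := (hGp ω hω).2.2.2.2.2.1
    have := (hGp _ (hGθ ω hω)).2.2.2.2.2.1
    have h1 := (hGp ω hω).2.2.2.2.2.2 _ (hone.holderNorm_lt_top hα hξ hQ.le)
    rw [integral_const, probReal_univ, smul_eq_mul, mul_one, mul_one] at h1
    have hint := (hcone ω hω _ hone).integrable hα hξ (ν (θ ω))
    rw [← h1]
    constructor
    · refine le_trans (by simp) (integral_mono (μ := ν (θ ω)) (integrable_const (Real.exp (-C)))
        hint fun x => ?_)
      obtain ⟨z, rfl⟩ := hT.surjective ω x
      simpa using hlow ω hω (fun _ => 1) (fun _ => zero_le_one) z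
    · refine (integral_mono (μ := ν (θ ω)) hint (integrable_const (D * Real.exp C))
        fun x => hup ω hω x).trans (by simp)
  have hDC : 0 ≤ D * Real.exp C := by positivity
  refine ⟨G, Q, s, (D * Real.exp C + 1)⁻¹ * Real.exp (-C), (Real.exp (-C))⁻¹ * (D * Real.exp C),
    N, (D * Real.exp C).toNNReal, hG, fun ω hω => (hGp ω hω).1, hGi, fun ω hω => ⟨hpos ω hω, ?_⟩,
    fun ω hω => (hGp ω hω).2.2.2.2.2.2, ?_⟩
  · rw [Real.coe_toNNReal _ hDC]; exact (hlam ω hω).2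
  exact
  { mapsTo := hGθ
    prob := fun ω hω => (hGp ω hω).2.2.2.2.2.1
    α_pos := hα
    ξ_pos := hξ
    Q_pos := hQ
    s_nonneg := by positivity
    s_lt_one := by rw [hs]; linarith
    a_pos := by positivity
    A_nonneg := by positivity
    N_pos := hN
    surjective := fun ω _ => hT.surjective ω
    add := fun ω hω f g => by
      ext x
      simp only [normalizedOp, (hGp ω hω).2.1.transferOp_add hξ, mul_add]
    const_mul := fun ω hω c g => by
      ext x
      simp only [normalizedOp, (hGp ω hω).2.1.transferOp_const_mul hξ]
      ring
    lower := fun ω hω g hg x => by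
      rw [normalizedOp, mul_assoc]
      refine mul_le_mul (inv_anti₀ (hpos ω hω) ?_) (hlow ω hω g hg x)
        (mul_nonneg (Real.exp_pos _).le (hg x)) (inv_nonneg.2 (hpos ω hω).le)
      linarith [(hlam ω hω).2]
    upper := fun ω hω x => mul_le_mul_of_nonneg (inv_anti₀ (Real.exp_pos _) (hlam ω hω).1)
      (hup ω hω x) (inv_nonneg.2 (hpos ω hω).le) hDC
    logHolder := fun ω hω g hg => (hcone ω hω g hg).const_mul (inv_nonneg.2 (hpos ω hω).le)
    integral := fun ω hω g hg => by
      simp only [normalizedOp]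
      rw [integral_const_mul,
        (hGp ω hω).2.2.2.2.2.2 g (hg.holderNorm_lt_top hα hξ hQ.le),
        inv_mul_cancel_left₀ (hpos ω hω).ne']
    exact := fun ω hω => (hGp ω hω).2.2.1 }

end Cocycle

/-- Probability measures with the same integrals of log-Hölder functions agree. -/
theorem ext_of_forall_logHolder {X : Type*} [MetricSpace X] [CompactSpace X] [MeasurableSpace X]
    [BorelSpace X] {μ ν : Measure X} [IsProbabilityMeasure μ] [IsProbabilityMeasure ν]
    {α ξ Q : ℝ} (hα0 : 0 < α) (hα1 : α ≤ 1) (hξ : 0 < ξ) (hQ : 0 < Q)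
    (h : ∀ f : X → ℝ, LogHolder α ξ Q f → ∫ x, f x ∂μ = ∫ x, f x ∂ν) : μ = ν := by
  refine ext_of_generate_finite _ (by rw [BorelSpace.measurable_eq (α := X),
    borel_eq_generateFrom_isClosed]) isPiSystem_isClosed (fun F hF => ?_) (by simp)
  have hδ : ∀ n : ℕ, 0 < 1 / ((n : ℝ) + 1) := fun n => Nat.one_div_pos_of_nat
  have hlim := tendsto_one_div_add_atTop_nhds_zero_nat (𝕜 := ℝ)
  refine tendsto_nhds_unique (tendsto_lintegral_thickenedIndicator_of_isClosed μ hF hδ hlim) ?_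
  refine (tendsto_lintegral_thickenedIndicator_of_isClosed ν hF hδ hlim).congr fun n => ?_
  set f := thickenedIndicator (hδ n) F
  have hLip : LipschitzWith _ f := lipschitzWith_thickenedIndicator (hδ n) F
  set K : ℝ≥0 := (1 / ((n : ℝ) + 1)).toNNReal⁻¹
  -- A `K`-Lipschitz function is `α`-Hölder at scale `ξ` with this constant, as `d = d^{1-α} d^α`
  -- and `α ≤ 1`. Shifted thickened indicators thus lie in the cone, and the shift cancels between
  -- probability measures.
  have hR : 0 ≤ K * ξ ^ (1 - α) := mul_nonneg K.2 (Real.rpow_nonneg hξ.le _)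
  have hcone := LogHolder.add_const_of_holder (α := α) (ξ := ξ) (g := fun x => (f x : ℝ))
    (q := K * ξ ^ (1 - α) / Q) hQ hR (fun x x' hx => ?_)
    (fun x => le_add_of_nonneg_left (f x).2)
  · have h1 := h _ hcone
    rw [integral_add (integrable_thickenedIndicator F (hδ n)) (integrable_const _),
      integral_add (integrable_thickenedIndicator F (hδ n)) (integrable_const _)] at h1
    simp only [integral_const, probReal_univ, add_left_inj] at h1
    rw [lintegral_coe_eq_integral _ (integrable_thickenedIndicator F (hδ n)),
      lintegral_coe_eq_integral _ (integrable_thickenedIndicator F (hδ n)), h1]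
  · have h1 : |(f x : ℝ) - f x'| ≤ K * dist x x' := hLip.dist_le_mul x x'
    refine h1.trans ?_
    rw [mul_assoc]
    refine mul_le_mul_of_nonneg_left ?_ K.2
    have h2 : dist x x' = dist x x' ^ (1 - α) * dist x x' ^ α := by
      rw [← Real.rpow_add_of_nonneg dist_nonneg (by linarith) hα0.le]
      simp
    calc dist x x' = dist x x' ^ (1 - α) * dist x x' ^ α := h2
      _ ≤ _ := mul_le_mul_of_nonneg_right
        (Real.rpow_le_rpow dist_nonneg hx.le (by linarith)) (Real.rpow_nonneg dist_nonneg _)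

/-! ### Triplets from conformal families: existence, uniqueness, bounds -/

section

variable {Ω X : Type*} [MeasurableSpace Ω] [MetricSpace X] [MeasurableSpace X]
  {P : Measure Ω} {θ : Ω ≃ᵐ Ω} {T : Ω → X → X} {ξ α : ℝ} {φ : Ω → X → ℝ}
  {lam : Ω → ℝ} {ν : Ω → Measure X}

theorem measurable_pullbackOne (hφ : IsPotential P T α ξ φ) (hlam : Measurable lam) (n : ℕ) :
    Measurable (fun p : Ω × X => pullbackOne (normalizedOp T φ lam) θ.symm n p.1 p.2) := by
  induction n with
  | zero => exact measurable_const
  | succ n ih =>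
    have h1 : Measurable fun p : Ω × X => (lam p.1)⁻¹ * transferOp (T p.1) (φ p.1)
        (pullbackOne (normalizedOp T φ lam) θ.symm n p.1) p.2 :=
      (hlam.comp measurable_fst).inv.mul (hφ.transfer _ ih)
    exact h1.comp ((θ.symm.measurable.comp measurable_fst).prodMk measurable_snd)

variable [CompactSpace X] [BorelSpace X]

/-- A conformal family can be completed to a Ruelle-Perron-Frobenius triplet. -/
theorem IsConformal.exists_triplet (hθ : MeasurePreserving θ P P)
    (hT : IsRandomExpanding P θ T ξ) (hα : 0 < α) (hφ : IsPotential P T α ξ φ)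
    (H : IsConformal P θ T α ξ φ lam ν) : ∃ h, IsRPFTriplet P θ T α ξ φ lam h ν := by
  obtain ⟨G, Q, s, a, A, N, Λ, hG, -, hGi, hlam, hconf, HN⟩ :=
    H.exists_normalizedCocycle hθ hT hα hφ (p := fun _ => True)
      (Eventually.of_forall fun _ => trivial)
  obtain ⟨c, B, hc, b, hb, h', hh'⟩ :=
    HN.exists_invariant θ.apply_symm_apply θ.symm_apply_apply hGi
  -- The pointwise limit `h'` is only chosen on `G`, without joint measurability; the limsup is
  -- measurable everywhere and agrees with it on `G`.
  set h : Ω → X → ℝ := fun ω x =>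
    limsup (fun n => pullbackOne (normalizedOp T φ lam) θ.symm n ω x) atTop with hdef
  have heq : ∀ ω ∈ G, h ω = h' ω := by
    intro ω hω
    ext x
    refine Tendsto.limsup_eq ?_
    rw [tendsto_iff_norm_sub_tendsto_zero]
    exact squeeze_zero' (Eventually.of_forall fun _ => norm_nonneg _)
      (eventually_atTop.2 ⟨N, fun n hn => (hh' ω hω).2.2.1 n x hn⟩) hb
  refine ⟨h, H.measurable_lam, ?_, H.measurable_ν, H.lam_pos, ?_, H.prob, ?_, ?_,
    H.eigenmeasure, ?_⟩
  · exact Measurable.limsup fun n => measurable_pullbackOne hφ H.measurable_lam n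
  · filter_upwards [hG] with ω hω x
    rw [heq ω hω]
    exact hc.trans_le ((hh' ω hω).2.1 x).1
  · refine ⟨max Λ ((max B 0).toNNReal + (Q * Real.exp (Q * ξ ^ α) * max B 0).toNNReal), ?_⟩
    filter_upwards [hG] with ω hω
    constructor
    · exact (hlam ω hω).2.trans (by exact_mod_cast le_max_left _ _)
    · rw [heq ω hω]
      exact ((hh' ω hω).1.holderNorm_le hα.le HN.Q_pos.le (le_max_right B 0)
        fun x => ((hh' ω hω).2.1 x).2.trans (le_max_left _ _)).trans
          (by exact_mod_cast le_max_right _ _)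
  · filter_upwards [hG] with ω hω x
    rw [heq ω hω, heq _ (HN.mapsTo ω hω), ← (hh' ω hω).2.2.2.1 x, normalizedOp,
      mul_inv_cancel_left₀ (hlam ω hω).1.ne']
  · filter_upwards [hG] with ω hω
    rw [heq ω hω]
    exact (hh' ω hω).2.2.2.2

/-- Conformal families are unique. -/
theorem IsConformal.ae_unique (hθ : MeasurePreserving θ P P)
    (hT : IsRandomExpanding P θ T ξ) (hα : 0 < α) (hα1 : α ≤ 1) (hφ : IsPotential P T α ξ φ)
    (H : IsConformal P θ T α ξ φ lam ν) {lam' : Ω → ℝ} {ν' : Ω → Measure X}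
    (H' : IsConformal P θ T α ξ φ lam' ν') : ∀ᵐ ω ∂P, ν' ω = ν ω ∧ lam' ω = lam ω := by
  obtain ⟨G, Q, s, a, A, N, Λ, hG, hGp, hGi, hlam, hconf, HN⟩ :=
    H.exists_normalizedCocycle hθ hT hα hφ (H'.prob.and H'.eigenmeasure)
  have hν : ∀ ω ∈ G, ν' ω = ν ω := by
    intro ω hω
    have := HN.prob ω hω
    have := (hGp ω hω).1
    refine ext_of_forall_logHolder hα hα1 HN.ξ_pos HN.Q_pos fun f hf => ?_
    -- The operators are normalised by `lam`, so the rival family scales by the ratio of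
    -- eigenvalues.
    refine HN.integral_eq_of_conformal (κ := fun ω => (lam ω)⁻¹ * lam' ω)
      (fun ω hω => (hGp ω hω).1) (fun ω hω g hg => ?_) hω hf
    simp only [normalizedOp]
    rw [integral_const_mul,
      (hGp ω hω).2 g (hg.holderNorm_lt_top hα HN.ξ_pos HN.Q_pos.le), mul_assoc]
  filter_upwards [hG] with ω hω
  refine ⟨hν ω hω, ?_⟩
  have hone : holderNorm α ξ (fun _ : X => (1 : ℝ)) < ∞ :=
    (LogHolder.const HN.Q_pos.le zero_le_one).holderNorm_lt_top hα HN.ξ_pos HN.Q_pos.le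
  have h1 := (hGp ω hω).2 _ hone
  rw [hν ω hω, hν _ (HN.mapsTo ω hω), hconf ω hω _ hone] at h1
  have := HN.prob ω hω
  simpa using h1.symm

/-- The eigenfunctions of a triplet are bounded away from zero and infinity. -/
theorem IsRPFTriplet.exists_bounds (hθ : MeasurePreserving θ P P)
    (hT : IsRandomExpanding P θ T ξ) (hα : 0 < α) (hφ : IsPotential P T α ξ φ)
    {h : Ω → X → ℝ} (H : IsRPFTriplet P θ T α ξ φ lam h ν) :
    ∃ c C : ℝ, 0 < c ∧ ∀ᵐ ω ∂P, ∀ x, c ≤ h ω x ∧ h ω x ≤ C := by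
  obtain ⟨C, hC⟩ := H.bounded
  obtain ⟨G, Q, s, a, A, N, Λ, hG, hGp, hGi, hlam, -, HN⟩ :=
    H.isConformal.exists_normalizedCocycle hθ hT hα hφ
      (hC.and (H.eigenfunction.and H.normalized))
  -- This shift brings `h ≥ -C`, with Hölder constant `C + 1`, up to the threshold of
  -- `add_const_of_holder`.
  have hq : 0 ≤ ((C : ℝ) + 1) / Q + C :=
    add_nonneg (div_nonneg (by positivity) HN.Q_pos.le) C.2
  have hcone : ∀ ω ∈ G, LogHolder α ξ Q (fun x => h ω x + (((C : ℝ) + 1) / Q + C)) := by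
    intro ω hω
    have hb := bounds_of_holderNorm_le (hGp ω hω).1.2
    refine LogHolder.add_const_of_holder HN.Q_pos (by positivity) hb.2 fun x => ?_
    linarith [(abs_le.1 (hb.1 x)).1]
  have hinv : ∀ ω ∈ G, ∀ x, normalizedOp T φ lam ω (h ω) x = h (θ ω) x := by
    intro ω hω x
    rw [normalizedOp, (hGp ω hω).2.1 x, inv_mul_cancel_left₀ (hlam ω hω).1.ne']
  obtain ⟨c, hc, hlow⟩ := HN.exists_lower_bound_of_invariant θ.apply_symm_apply hGi hq hcone
    (fun ω hω => (hGp ω hω).2.2) hinv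
  refine ⟨c, C, hc, ?_⟩
  filter_upwards [hG] with ω hω x
  exact ⟨hlow ω hω x, (le_abs_self _).trans ((bounds_of_holderNorm_le (hGp ω hω).1.2).1 x)⟩

end

/-! ### Change of variables for the Jacobian -/

/-- The point `y` is isolated in its finite fibre. If `u`, `v` near `y` have the same image, their
partners in the fibre of `S y` are both so close to `y` that they equal `y`; hence `u` and `v` carry
the same index. -/
theorem PairedFibers.exists_injOn_ball {X : Type*} [MetricSpace X] {S : X → X} {ξ τ D : ℝ}
    (h : PairedFibers S ξ τ D) (hξ : 0 < ξ) (hτ1 : τ ≤ 1) (hS : Continuous S) (y : X) :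
    ∃ r > 0, Set.InjOn S (Metric.ball y r) := by
  have hy : y ∈ S ⁻¹' {S y} := rfl
  obtain ⟨ε, hε, hεsep⟩ : ∃ ε > 0, ∀ z ∈ S ⁻¹' {S y}, dist z y < ε → z = y := by
    have hfin := (h.finite_fiber hξ (S y)).subset (Set.sdiff_subset (t := {y}))
    obtain ⟨ε, hε, hball⟩ := Metric.isOpen_iff.1 hfin.isClosed.isOpen_compl y (by simp)
    refine ⟨ε, hε, fun z hz hd => ?_⟩
    by_contra hne
    exact hball hd ⟨hz, hne⟩
  obtain ⟨r, hr, hrS⟩ := Metric.continuousAt_iff.1 (hS.continuousAt (x := y)) (min ξ (ε / 2))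
    (by positivity)
  refine ⟨min r (ε / 2), by positivity, fun u hu v hv huv => ?_⟩
  rw [Metric.mem_ball, lt_min_iff] at hu hv
  have hSu := hrS hu.1
  rw [lt_min_iff, dist_comm] at hSu
  obtain ⟨k, p, p', -, hp, hp', hr, hr', hd⟩ := h (S y) (S u) hSu.1
  have key : ∀ w, S w = S u → dist w y < ε / 2 → ∃ i, p i = y ∧ p' i = w := by
    intro w hw hwy
    obtain ⟨i, rfl⟩ : w ∈ Set.range p' := by rw [hr']; exact hw
    refine ⟨i, hεsep _ (hr ▸ Set.mem_range_self i) ?_, rfl⟩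
    have h1 := (hd i).trans (mul_le_of_le_one_left dist_nonneg hτ1)
    have h2 := dist_triangle (p i) (p' i) y
    have h3 := hSu.2
    linarith
  obtain ⟨i, hi, hi'⟩ := key u rfl hu.2
  obtain ⟨j, hj, hj'⟩ := key v huv.symm hv.2
  rw [← hi', ← hj', hp (hi.trans hj.symm)]

section Jacobian

variable {X : Type*} [MetricSpace X] [CompactSpace X] [MeasurableSpace X] [BorelSpace X]
  {S : X → X} {m : Measure X} {J : X → ℝ≥0}

/-- On `A` the map is a measurable embedding, and the Jacobian identity says that `m` pulled back
along it is `J m` on `A`. Each fibre sum has at most one nonzero term. -/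
theorem IsJacobian.integral_finsum_of_injOn (hJ : IsJacobian m S J) (hS : Continuous S)
    {A : Set X} (hA : MeasurableSet A) (hinj : Set.InjOn S A) {F : X → ℝ}
    (hF : Integrable F (m.withDensity fun x => (J x : ℝ≥0∞))) :
    Integrable (fun x => ∑ᶠ y ∈ S ⁻¹' {x}, A.indicator F y) m ∧
      ∫ x, ∑ᶠ y ∈ S ⁻¹' {x}, A.indicator F y ∂m =
        ∫ x in A, F x ∂(m.withDensity fun x => (J x : ℝ≥0∞)) := by
  set μ := m.withDensity fun x => (J x : ℝ≥0∞)
  set f : A → X := fun a => S a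
  have : StandardBorelSpace A := hA.standardBorel
  have hf : MeasurableEmbedding f := (hS.comp continuous_subtype_val).measurable.measurableEmbedding
    fun a b hab => Subtype.ext (hinj a.2 b.2 hab)
  have hcoe := MeasurableEmbedding.subtype_coe hA
  have hcomap : m.comap f = μ.comap (Subtype.val : A → X) := by
    ext B hB
    have hB' := hcoe.measurableSet_image.2 hB
    rw [hf.comap_apply, hcoe.comap_apply, withDensity_apply _ hB', ← hJ.image _ hB'
      (hinj.mono (Subtype.coe_image_subset A B)), Set.image_image]
  set g : X → ℝ := fun x => ∑ᶠ y ∈ S ⁻¹' {x}, A.indicator F y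
  have hgf : ∀ a : A, g (f a) = F a := by
    intro a
    have h1 : ∀ y, y ≠ (a : X) → (∑ᶠ _ : y ∈ S ⁻¹' {f a}, A.indicator F y) = 0 := by
      intro y hy
      by_cases hyS : y ∈ S ⁻¹' {f a}
      · rw [Set.indicator_of_notMem (fun hyA => hy (hinj hyA a.2 hyS)), finsum_zero]
      · exact haveI : IsEmpty (y ∈ S ⁻¹' {f a}) := ⟨hyS⟩; finsum_of_isEmpty _
    have h2 : (a : X) ∈ S ⁻¹' {f a} := rfl
    simp only [g]
    rw [finsum_eq_single _ (a : X) h1, finsum_eq_indicator_apply,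
      Set.indicator_of_mem h2, Set.indicator_of_mem a.2]
  have hg0 : ∀ x, x ∉ Set.range f → g x = 0 := by
    intro x hx
    refine finsum_mem_eq_zero_of_forall_eq_zero fun y hy => Set.indicator_of_notMem (fun hyA => ?_) F
    exact hx ⟨⟨y, hyA⟩, hy⟩
  have hgF : g ∘ f = F ∘ (Subtype.val : A → X) := funext hgf
  constructor
  · rw [← integrableOn_iff_integrable_of_support_subset (s := Set.range f)
      (fun x hx => by_contra fun h => hx (hg0 x h)), IntegrableOn, ← hf.map_comap,
      hf.integrable_map_iff, hgF, hcomap, ← hcoe.integrable_map_iff, hcoe.map_comap]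
    exact hF.mono_measure Measure.restrict_le_self
  · rw [← setIntegral_eq_integral_of_forall_compl_eq_zero (s := Set.range f) hg0,
      ← hf.map_comap, hf.integral_map]
    simp only [hgf]
    rw [hcomap, ← hcoe.integral_map (g := F), hcoe.map_comap, Subtype.range_coe]

variable {ξ τ D : ℝ}

/-- By compactness finitely many injectivity balls cover `X`. Each new ball is cut down by the union
of the earlier ones, so the injective case adds up. -/
theorem IsJacobian.integral_finsum (hJ : IsJacobian m S J) (hS : Continuous S)
    (hpair : PairedFibers S ξ τ D) (hξ : 0 < ξ) (hτ1 : τ ≤ 1) {F : X → ℝ}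
    (hF : Integrable F (m.withDensity fun x => (J x : ℝ≥0∞))) :
    ∫ x, ∑ᶠ y ∈ S ⁻¹' {x}, F y ∂m = ∫ x, F x ∂(m.withDensity fun x => (J x : ℝ≥0∞)) := by
  classical
  choose r hr hinj using hpair.exists_injOn_ball hξ hτ1 hS
  obtain ⟨t, ht⟩ := CompactSpace.elim_nhds_subcover (fun y => Metric.ball y (r y))
    fun y => Metric.ball_mem_nhds y (hr y)
  have key : ∀ t : Finset X, Integrable
      (fun x => ∑ᶠ y ∈ S ⁻¹' {x}, (⋃ z ∈ t, Metric.ball z (r z)).indicator F y) m ∧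
      ∫ x, ∑ᶠ y ∈ S ⁻¹' {x}, (⋃ z ∈ t, Metric.ball z (r z)).indicator F y ∂m =
        ∫ x in ⋃ z ∈ t, Metric.ball z (r z), F x ∂(m.withDensity fun x => (J x : ℝ≥0∞)) := by
    intro t
    induction t using Finset.induction_on with
    | empty => simp
    | insert z t _ ih =>
      have hU : MeasurableSet (⋃ z ∈ t, Metric.ball z (r z)) :=
        t.measurableSet_biUnion fun z _ => measurableSet_ball
      rw [Finset.set_biUnion_insert, ← Set.sdiff_union_self]
      set U := ⋃ z ∈ t, Metric.ball z (r z)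
      have hB : MeasurableSet (Metric.ball z (r z) \ U) := measurableSet_ball.diff hU
      have h1 := hJ.integral_finsum_of_injOn hS hB ((hinj z).mono Set.sdiff_subset) hF
      have hsum : ∀ x, ∑ᶠ y ∈ S ⁻¹' {x}, ((Metric.ball z (r z) \ U) ∪ U).indicator F y =
          (∑ᶠ y ∈ S ⁻¹' {x}, (Metric.ball z (r z) \ U).indicator F y) +
            ∑ᶠ y ∈ S ⁻¹' {x}, U.indicator F y := by
        intro x
        rw [Set.indicator_union_of_disjoint Set.disjoint_sdiff_left]
        exact finsum_mem_add_distrib (hpair.finite_fiber hξ x)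
      simp only [hsum]
      refine ⟨h1.1.add ih.1, ?_⟩
      rw [integral_add h1.1 ih.1, h1.2, ih.2,
        setIntegral_union Set.disjoint_sdiff_left hU hF.integrableOn hF.integrableOn]
  have := (key t).2
  rw [ht] at this
  simpa using this

/-- Inside an injectivity ball the zero set of `J` has null image, so non-singularity makes it null.
This is needed because `Real.log 0 = 0`, so that `J * exp (-log J) = 1` fails where `J = 0`. -/
theorem IsJacobian.ae_ne_zero (hJ : IsJacobian m S J) (hS : Continuous S)
    (hpair : PairedFibers S ξ τ D) (hξ : 0 < ξ) (hτ1 : τ ≤ 1) (hns : m.map S ≪ m) :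
    ∀ᵐ x ∂m, J x ≠ 0 := by
  choose r hr hinj using hpair.exists_injOn_ball hξ hτ1 hS
  obtain ⟨t, ht⟩ := CompactSpace.elim_nhds_subcover (fun y => Metric.ball y (r y))
    fun y => Metric.ball_mem_nhds y (hr y)
  have hZ : MeasurableSet (J ⁻¹' {0}) := hJ.measurable (measurableSet_singleton 0)
  have hnull : ∀ z, m (Metric.ball z (r z) ∩ J ⁻¹' {0}) = 0 := by
    intro z
    have h1 := hJ.image _ (measurableSet_ball.inter hZ) ((hinj z).mono Set.inter_subset_left)
    rw [setLIntegral_congr_fun (g := fun _ => 0) (measurableSet_ball.inter hZ)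
      (fun x hx => by simpa using hx.2), lintegral_zero] at h1
    have h2 := hns h1
    refine measure_mono_null (Set.subset_preimage_image S _) (le_antisymm ?_ bot_le)
    rw [← h2]
    exact Measure.le_map_apply hS.measurable.aemeasurable _
  have hcover : {x | ¬ J x ≠ 0} ⊆ ⋃ z ∈ t, Metric.ball z (r z) ∩ J ⁻¹' {0} := by
    intro x hx
    have : x ∈ ⋃ z ∈ t, Metric.ball z (r z) := ht ▸ Set.mem_univ x
    simp only [Set.mem_iUnion] at this ⊢
    obtain ⟨z, hz, hxz⟩ := this
    exact ⟨z, hz, hxz, not_not.1 hx⟩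
  exact measure_mono_null hcover ((measure_biUnion_null_iff t.countable_toSet).2 fun z _ => hnull z)

/-- The transfer operator of a potential cohomologous to `-log J + K` has the eigenvalue `e^K` and
the dual eigenmeasure `e^ψ m`. -/
theorem IsJacobian.integral_transferOp (hJ : IsJacobian m S J) (hS : Continuous S)
    (hpair : PairedFibers S ξ τ D) (hξ : 0 < ξ) (hτ1 : τ ≤ 1) (hns : m.map S ≪ m)
    {f g ψ ψ' : X → ℝ} {K : ℝ} (hψ : ∀ᵐ x ∂m, f x = -Real.log (J x) + ψ x - ψ' (S x) + K)
    (hint : Integrable (fun x => Real.exp (ψ x) * g x) m) :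
    ∫ x, Real.exp (ψ' x) * transferOp S f g x ∂m =
      Real.exp K * ∫ x, Real.exp (ψ x) * g x ∂m := by
  -- On the fibre over `x` the factor `e^{ψ' x}` is `e^{ψ' (S y)}`, so it moves inside the sum;
  -- multiplying by `J` then cancels the coboundary.
  set F : X → ℝ := fun y => Real.exp (ψ' (S y)) * (Real.exp (f y) * g y)
  have hJF : (fun x => J x • F x) =ᵐ[m] fun x => Real.exp K * (Real.exp (ψ x) * g x) := by
    filter_upwards [hψ, hJ.ae_ne_zero hS hpair hξ hτ1 hns] with x h1 h2
    have hpos : (0 : ℝ) < J x := by exact_mod_cast pos_iff_ne_zero.2 h2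
    have h3 : J x * Real.exp (f x) * Real.exp (ψ' (S x)) = Real.exp K * Real.exp (ψ x) := by
      conv_lhs => rw [← Real.exp_log hpos]
      rw [h1, ← Real.exp_add, ← Real.exp_add, ← Real.exp_add]
      congr 1
      ring
    simp only [F, NNReal.smul_def, smul_eq_mul]
    linear_combination g x * h3
  have hFint : Integrable F (m.withDensity fun x => (J x : ℝ≥0∞)) := by
    rw [integrable_withDensity_iff_integrable_smul hJ.measurable]
    exact (hint.const_mul _).congr hJF.symm
  have hfin : ∀ x, Real.exp (ψ' x) * transferOp S f g x = ∑ᶠ y ∈ S ⁻¹' {x}, F y := by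
    intro x
    obtain ⟨k, y, -, hy, hr⟩ := hpair.exists_enum hξ x
    rw [transferOp_eq_sum f g hy hr, ← hr, finsum_mem_range hy, finsum_eq_sum_of_fintype,
      Finset.mul_sum]
    refine Finset.sum_congr rfl fun i _ => ?_
    have : S (y i) = x := by
      have : y i ∈ S ⁻¹' {x} := hr ▸ Set.mem_range_self i
      exact this
    simp only [F, this]
  simp only [hfin]
  rw [hJ.integral_finsum hS hpair hξ hτ1 hFint,
    integral_withDensity_eq_integral_smul hJ.measurable, integral_congr_ae hJF,
    integral_const_mul]

end Jacobian

/-! ### Conformal families from the Jacobian -/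

theorem equivWithBounds_withDensity {X : Type*} [MeasurableSpace X] {m : Measure X}
    [IsFiniteMeasure m] {d : X → ℝ} (hd : Measurable d) {c C : ℝ} (hc : 0 < c)
    (hcd : ∀ x, c ≤ d x) (hdC : ∀ x, d x ≤ C) :
    EquivWithBounds (m.withDensity fun x => ENNReal.ofReal (d x)) m c C := by
  refine ⟨withDensity_absolutelyContinuous _ _, ?_, ?_⟩
  · refine withDensity_absolutelyContinuous' hd.ennreal_ofReal.aemeasurable
      (Eventually.of_forall fun x => ?_)
    exact (ENNReal.ofReal_pos.2 (hc.trans_le (hcd x))).ne'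
  · filter_upwards [Measure.rnDeriv_withDensity m hd.ennreal_ofReal] with x hx
    rw [hx]
    exact ⟨ENNReal.ofReal_le_ofReal (hcd x), ENNReal.ofReal_le_ofReal (hdC x)⟩

/-- The probability density proportional to `e^ψ`. -/
noncomputable def expDensity {X : Type*} [MeasurableSpace X] (m : Measure X) (ψ : X → ℝ) (x : X) :
    ℝ :=
  (∫ y, Real.exp (ψ y) ∂m)⁻¹ * Real.exp (ψ x)

section

variable {X : Type*} [MeasurableSpace X] {m : Measure X}

theorem integral_withDensity_expDensity {ψ : X → ℝ} (hψ : Measurable ψ) (g : X → ℝ) :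
    ∫ x, g x ∂(m.withDensity fun x => ENNReal.ofReal (expDensity m ψ x)) =
      (∫ y, Real.exp (ψ y) ∂m)⁻¹ * ∫ x, Real.exp (ψ x) * g x ∂m := by
  have hd : Measurable (expDensity m ψ) := measurable_const.mul hψ.exp
  have h0 : ∀ x, 0 ≤ expDensity m ψ x := fun x =>
    mul_nonneg (inv_nonneg.2 (integral_nonneg fun _ => (Real.exp_pos _).le)) (Real.exp_pos _).le
  rw [integral_withDensity_eq_integral_toReal_smul hd.ennreal_ofReal
    (Eventually.of_forall fun _ => ENNReal.ofReal_lt_top), ← integral_const_mul]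
  refine integral_congr_ae (Eventually.of_forall fun x => ?_)
  beta_reduce
  rw [ENNReal.toReal_ofReal (h0 x), smul_eq_mul, expDensity, mul_assoc]

variable [IsProbabilityMeasure m]

theorem integrable_exp_of_bounded {ψ : X → ℝ} (hψ : Measurable ψ) {B : ℝ} (hB : ∀ x, |ψ x| ≤ B) :
    Integrable (fun x => Real.exp (ψ x)) m := by
  refine Integrable.of_bound hψ.exp.aestronglyMeasurable (Real.exp B)
    (Eventually.of_forall fun x => ?_)
  rw [Real.norm_of_nonneg (Real.exp_pos _).le]
  exact Real.exp_le_exp.2 (abs_le.1 (hB x)).2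

theorem integral_exp_bounds {ψ : X → ℝ} (hψ : Measurable ψ) {B : ℝ} (hB : ∀ x, |ψ x| ≤ B) :
    Real.exp (-B) ≤ ∫ x, Real.exp (ψ x) ∂m ∧ ∫ x, Real.exp (ψ x) ∂m ≤ Real.exp B := by
  constructor
  · refine le_trans (by simp) (integral_mono (μ := m) (integrable_const (Real.exp (-B)))
      (integrable_exp_of_bounded hψ hB) fun x => Real.exp_le_exp.2 (abs_le.1 (hB x)).1)
  · exact (integral_mono (μ := m) (integrable_exp_of_bounded hψ hB) (integrable_const (Real.exp B))
      fun x => Real.exp_le_exp.2 (abs_le.1 (hB x)).2).trans (by simp)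

/-- One `B` comes from `e^ψ` and the other from its normalising integral. -/
theorem expDensity_bounds {ψ : X → ℝ} (hψ : Measurable ψ) {B : ℝ} (hB : ∀ x, |ψ x| ≤ B) (x : X) :
    Real.exp (-(2 * B)) ≤ expDensity m ψ x ∧ expDensity m ψ x ≤ Real.exp (2 * B) := by
  obtain ⟨h1, h2⟩ := integral_exp_bounds (m := m) hψ hB
  have hpos := (Real.exp_pos (-B)).trans_le h1
  have h3 : Real.exp (-B) ≤ (∫ y, Real.exp (ψ y) ∂m)⁻¹ := by
    rw [Real.exp_neg]; exact inv_anti₀ hpos h2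
  have h4 : (∫ y, Real.exp (ψ y) ∂m)⁻¹ ≤ Real.exp B := by
    rw [← inv_inv (Real.exp B), ← Real.exp_neg]
    exact inv_anti₀ (Real.exp_pos _) h1
  have h5 := abs_le.1 (hB x)
  constructor
  · calc Real.exp (-(2 * B)) = Real.exp (-B) * Real.exp (-B) := by rw [← Real.exp_add]; ring_nf
      _ ≤ _ := mul_le_mul h3 (Real.exp_le_exp.2 h5.1) (Real.exp_pos _).le (inv_nonneg.2 hpos.le)
  · calc expDensity m ψ x ≤ Real.exp B * Real.exp B :=
        mul_le_mul h4 (Real.exp_le_exp.2 h5.2) (Real.exp_pos _).le (Real.exp_pos _).le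
      _ = _ := by rw [← Real.exp_add]; ring_nf

theorem isProbabilityMeasure_withDensity_expDensity {ψ : X → ℝ} (hψ : Measurable ψ) {B : ℝ}
    (hB : ∀ x, |ψ x| ≤ B) :
    IsProbabilityMeasure (m.withDensity fun x => ENNReal.ofReal (expDensity m ψ x)) := by
  have hpos := (Real.exp_pos (-B)).trans_le (integral_exp_bounds (m := m) hψ hB).1
  constructor
  rw [withDensity_apply _ MeasurableSet.univ, Measure.restrict_univ,
    ← ofReal_integral_eq_lintegral_ofReal (f := expDensity m ψ)
      ((integrable_exp_of_bounded hψ hB).const_mul _)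
      (Eventually.of_forall fun x =>
        (Real.exp_pos _).le.trans (expDensity_bounds hψ hB x).1)]
  simp only [expDensity]
  rw [integral_const_mul, inv_mul_cancel₀ hpos.ne', ENNReal.ofReal_one]

end

/-- If the potential is cohomologous to `-log J + K` then the measures with densities proportional
to `e^ψ` are conformal. -/
theorem isConformal_expDensity {Ω X : Type*} [MeasurableSpace Ω]
    [MetricSpace X] [CompactSpace X] [MeasurableSpace X] [BorelSpace X]
    {P : Measure Ω} {θ : Ω → Ω} (hθ : Measurable θ)
    {T : Ω → X → X} {ξ α : ℝ} (hT : IsRandomExpanding P θ T ξ) (hα : 0 < α)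
    {φ : Ω → X → ℝ}
    {m : Measure X} [IsProbabilityMeasure m] (hns : ∀ᵐ ω ∂P, m.map (T ω) ≪ m)
    {J : Ω → X → ℝ≥0} (hJ : ∀ᵐ ω ∂P, IsJacobian m (T ω) (J ω))
    {ψ : Ω → X → ℝ} {K : Ω → ℝ} (hψ : Measurable (fun p : Ω × X => ψ p.1 p.2))
    {B : ℝ} (hB : ∀ ω x, |ψ ω x| ≤ B) (hK : Measurable K)
    (hcoh : ∀ᵐ ω ∂P, ∀ᵐ x ∂m, φ ω x = -Real.log (J ω x) + ψ ω x - ψ (θ ω) (T ω x) + K ω) :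
    IsConformal P θ T α ξ φ
      (fun ω => (∫ x, Real.exp (ψ (θ ω) x) ∂m)⁻¹ * (Real.exp (K ω) * ∫ x, Real.exp (ψ ω x) ∂m))
      (fun ω => m.withDensity fun x => ENNReal.ofReal (expDensity m (ψ ω) x)) := by
  have hψω : ∀ ω, Measurable (ψ ω) := fun ω => hψ.comp measurable_prodMk_left
  have hZ : Measurable fun ω => ∫ x, Real.exp (ψ ω x) ∂m :=
    (hψ.exp.stronglyMeasurable.integral_prod_right').measurable
  have hZpos : ∀ ω, 0 < ∫ x, Real.exp (ψ ω x) ∂m := fun ω =>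
    (Real.exp_pos _).trans_le (integral_exp_bounds (hψω ω) (hB ω)).1
  obtain ⟨τ, D, hτ0, hτ1, -, hpair⟩ := hT.exists_pairedFibers
  refine ⟨(hZ.comp hθ).inv.mul (hK.exp.mul hZ), ?_, Eventually.of_forall fun ω => ?_,
    Eventually.of_forall fun ω => isProbabilityMeasure_withDensity_expDensity (hψω ω) (hB ω), ?_⟩
  · refine Measure.measurable_of_measurable_coe _ fun s hs => ?_
    simp only [withDensity_apply _ hs]
    have hd : Measurable fun p : Ω × X => ENNReal.ofReal (expDensity m (ψ p.1) p.2) :=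
      ((hZ.comp measurable_fst).inv.mul hψ.exp).ennreal_ofReal
    exact hd.lintegral_prod_right'
  · have := hZpos ω
    have := hZpos (θ ω)
    positivity
  · filter_upwards [hpair, hns, hJ, hcoh] with ω h1 h2 h3 h4 g hg
    obtain ⟨M, hM⟩ : ∃ M : ℝ≥0, holderNorm α ξ g ≤ M := ⟨_, (ENNReal.coe_toNNReal hg.ne).ge⟩
    have hgb := bounds_of_holderNorm_le hM
    -- A suitable shift of `g` lies in the cone with `Q = 1`, whose members are continuous; this
    -- gives the measurability needed to integrate `e^ψ g`.
    have hgc : Continuous g := by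
      have h5 := LogHolder.add_const_of_holder one_pos (by positivity) hgb.2
        (q := ((M : ℝ) + 1) / 1 + M) fun x => by linarith [(abs_le.1 (hgb.1 x)).1]
      refine ((h5.continuous hα hT.pos).sub
        (continuous_const (y := ((M : ℝ) + 1) / 1 + M))).congr fun x => ?_
      simp
    rw [integral_withDensity_expDensity (hψω _), integral_withDensity_expDensity (hψω _),
      h3.integral_transferOp (hT.continuous ω) h1 hT.pos hτ1.le h2 h4
        ((integrable_exp_of_bounded (hψω ω) (hB ω)).mul_bdd hgc.aestronglyMeasurable
          (Eventually.of_forall hgb.1))]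
    rw [mul_assoc, mul_assoc, mul_inv_cancel_left₀ (hZpos ω).ne']

end RandomRPF

/-! ### Assembly of the two statements -/

theorem mainTheorem12 {Ω X : Type*} [MeasurableSpace Ω]
    [MetricSpace X] [CompactSpace X] [MeasurableSpace X] [BorelSpace X]
    (P : Measure Ω) [IsProbabilityMeasure P] (hP : P.IsComplete)
    (θ : Ω ≃ᵐ Ω) (hθ : Ergodic θ P)
    (T : Ω → X → X) (ξ : ℝ) (hT : RandomRPF.IsRandomExpanding P θ T ξ)
    (α : ℝ) (hα0 : 0 < α) (hα1 : α ≤ 1)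
    (φ : Ω → X → ℝ) (hφ : RandomRPF.IsPotential P T α ξ φ)
    (m : Measure X) [IsProbabilityMeasure m]
    (hns : ∀ᵐ ω ∂P, m.map (T ω) ≪ m)
    (J : Ω → X → ℝ≥0) (hJ : ∀ᵐ ω ∂P, RandomRPF.IsJacobian m (T ω) (J ω)) :
    ((∀ᵐ ω ∂P, ∀ᵐ x ∂m, φ ω x = -Real.log (J ω x)) →
      (∃ (lam : Ω → ℝ) (h : Ω → X → ℝ) (ν : Ω → Measure X),
        RandomRPF.IsRPFTriplet P θ T α ξ φ lam h ν) ∧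
      ∀ (lam : Ω → ℝ) (h : Ω → X → ℝ) (ν : Ω → Measure X),
        RandomRPF.IsRPFTriplet P θ T α ξ φ lam h ν →
        ∀ᵐ ω ∂P, ν ω = m ∧ lam ω = 1) ∧
    (∀ (ψ : Ω → X → ℝ) (K : Ω → ℝ), Measurable (fun p : Ω × X => ψ p.1 p.2) →
      (∃ B : ℝ, ∀ ω x, |ψ ω x| ≤ B) → Measurable K →
      (∀ᵐ ω ∂P, ∀ᵐ x ∂m,
        φ ω x = -Real.log (J ω x) + ψ ω x - ψ (θ ω) (T ω x) + K ω) →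
      (∃ (lam : Ω → ℝ) (h : Ω → X → ℝ) (ν : Ω → Measure X),
        RandomRPF.IsRPFTriplet P θ T α ξ φ lam h ν) ∧
      ∀ (lam : Ω → ℝ) (h : Ω → X → ℝ) (ν : Ω → Measure X),
        RandomRPF.IsRPFTriplet P θ T α ξ φ lam h ν →
        ∃ c C : ℝ, 0 < c ∧ ∀ᵐ ω ∂P,
          RandomRPF.EquivWithBounds (ν ω) m c C ∧
          RandomRPF.EquivWithBounds
            ((ν ω).withDensity (fun x => ENNReal.ofReal (h ω x))) m c C) := by
  have hθm := hθ.toMeasurePreserving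
  constructor
  · intro hcoh
    have hone : (fun x : X => ENNReal.ofReal (RandomRPF.expDensity m (fun _ => 0) x)) =
        fun _ => 1 := by
      simp [RandomRPF.expDensity]
    have hconf : RandomRPF.IsConformal P θ T α ξ φ (fun _ => 1) (fun _ => m) := by
      have h := RandomRPF.isConformal_expDensity (K := fun _ => 0) θ.measurable hT hα0 hns hJ
        (ψ := fun _ _ => 0) (B := 0) measurable_const (by simp) measurable_const
        (by simpa using hcoh)
      simpa [hone] using h
    refine ⟨?_, fun lam h ν hR => hconf.ae_unique hθm hT hα0 hα1 hφ hR.isConformal⟩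
    obtain ⟨h, hh⟩ := hconf.exists_triplet hθm hT hα0 hφ
    exact ⟨_, h, _, hh⟩
  · rintro ψ K hψ ⟨B, hB⟩ hK hcoh
    have hconf := RandomRPF.isConformal_expDensity θ.measurable hT hα0 hns hJ hψ hB hK hcoh
    refine ⟨?_, fun lam h ν hR => ?_⟩
    · obtain ⟨h, hh⟩ := hconf.exists_triplet hθm hT hα0 hφ
      exact ⟨_, h, _, hh⟩
    have huniq := hconf.ae_unique hθm hT hα0 hα1 hφ hR.isConformal
    obtain ⟨c, C, hc, hbd⟩ := hR.exists_bounds hθm hT hα0 hφ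
    set b := Real.exp (2 * B)
    set a := Real.exp (-(2 * B))
    have ha : 0 < a := Real.exp_pos _
    have hb : 0 < b := Real.exp_pos _
    -- By uniqueness the density of `ν ω` lies in `[a, b]`; multiplied by `h ω` it lies in `[a * c,
    -- b * C]`. These constants serve both measures.
    refine ⟨min a (a * c), max b (b * C), by positivity, ?_⟩
    filter_upwards [huniq, hbd] with ω h1 h2
    have hd := RandomRPF.expDensity_bounds (m := m)
      (hψ.comp (measurable_prodMk_left (x := ω))) (hB ω)
    have hdm : Measurable (RandomRPF.expDensity m (ψ ω)) :=
      measurable_const.mul (hψ.comp (measurable_prodMk_left (x := ω))).exp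
    have hhm : Measurable (h ω) := hR.measurable_h.comp measurable_prodMk_left
    rw [h1.1]
    constructor
    · exact RandomRPF.equivWithBounds_withDensity hdm (by positivity)
        (fun x => (min_le_left _ _).trans (hd x).1) (fun x => (hd x).2.trans (le_max_left _ _))
    · rw [← withDensity_mul _ hdm.ennreal_ofReal hhm.ennreal_ofReal]
      have hmul : ((fun x => ENNReal.ofReal (RandomRPF.expDensity m (ψ ω) x)) *
          fun x => ENNReal.ofReal (h ω x)) =
          fun x => ENNReal.ofReal (RandomRPF.expDensity m (ψ ω) x * h ω x) := by
        ext x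
        exact (ENNReal.ofReal_mul (ha.le.trans (hd x).1)).symm
      rw [hmul]
      exact RandomRPF.equivWithBounds_withDensity (hdm.mul hhm) (by positivity)
        (fun x => (min_le_right _ _).trans
          (mul_le_mul (hd x).1 (h2 x).1 hc.le (ha.le.trans (hd x).1)))
        (fun x => (mul_le_mul (hd x).2 (h2 x).2 (hc.le.trans (h2 x).1) hb.le).trans
          (le_max_right _ _))
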